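/- **Setting.** A *general hyperbolic manifold* $M$ is a 3-manifold with (possibly empty) boundary, with an atlas of charts that embed open subsets of $M$ in hyperbolic space $\mathbb H^3$ (near the boundary the image need not be open or convex) and whose transition maps are locally restrictions of isometries of $\mathbb H^3$; it carries the length metric induced by the charts, is complete, and has a locally finite triangulation by hyperbolic tetrahedra. A *compact triangulated surface* $\Sigma$ is obtained from finitely many triangles by identifying some of their sides in pairs; it need not be connected, and the sides that are not identified form $\partial\Sigma$. A *triangulated map* $f:\Sigma\to M$ maps each triangle to a totally geodesic hyperbolic triangle of $M$, with three distinct vertices (which may lie on a geodesic). Angles of triangles, $\mathrm{Area}(\Sigma)$ (the sum of the areas of the triangles) and lengths of sides are those of the hyperbolic triangles induced by $f$. Angles between geodesics of a metric space are upper (Alexandrov) angles. Let $v_1,\dots,v_n$ ($n\ge 0$) be distinct vertices on $\partial\Sigma$. The map $f$ is an *h-map relative to* $v_1,\dots,v_n$ if the sum of the angles of the triangles around each interior vertex is at least $2\pi$, and around each boundary vertex other than the $v_i$ it is at least $\pi$. **Theorem.** Let $f:\Sigma\to M$ be an h-map relative to $v_1,\dots,v_n$ from a compact triangulated surface into a general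 hyperbolic manifold, and suppose that $f$ maps each component of $\partial\Sigma\setminus\{v_1,\dots,v_n\}$ to a (local) geodesic of $M$. Let $\theta_i$ be the exterior angle at $v_i$, that is, $\pi$ minus the angle in $M$ between the two boundary geodesics issuing from $v_i$. Then $$\mathrm{Area}(\Sigma)\le\sum_{i=1}^n\theta_i-2\pi\chi(\Sigma).$$ The same inequality holds if $\theta_i$ is replaced by the exterior angle measured in $\Sigma$, which is $\pi$ minus the sum of the angles at $v_i$ of the triangles of $\Sigma$. Consequently, if $n\ge1$ and $\Sigma$ is a closed disk (an h-mapped $n$-gon), then $\mathrm{Area}(\Sigma)\le(n-2)\pi$. -/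

import Mathlib

open Real Set Filter Topology MeasureTheory
open scoped UpperHalfPlane

noncomputable section

/-! ### Geodesics, convexity and angles in metric spaces -/

namespace GH

/-- The union of all shortest geodesics between two points of a geodesic metric space. -/
def geodSegment {X : Type*} [MetricSpace X] (x y : X) : Set X :=
  {z | dist x z + dist z y = dist x y}

/-- Geodesic convexity. -/
def GeodConvex {X : Type*} [MetricSpace X] (C : Set X) : Prop :=
  ∀ x ∈ C, ∀ y ∈ C, geodSegment x y ⊆ C

/-- Geodesic convex hull.  In a hyperbolic space the hull of the vertices of a simplex is the
geodesic simplex with these vertices. -/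
def geodHull {X : Type*} [MetricSpace X] (S : Set X) : Set X :=
  ⋂₀ {C | S ⊆ C ∧ GeodConvex C}

/-- A path is a local geodesic on the interval `I`: every `t ∈ I` has a neighbourhood in `I` on
which distances are differences of parameters. -/
def IsLocalGeodesicOn {X : Type*} [MetricSpace X] (c : ℝ → X) (I : Set ℝ) : Prop :=
  ∀ t ∈ I, ∃ ε > 0, ∀ s ∈ I, ∀ s' ∈ I, |s - t| < ε → |s' - t| < ε →
    dist (c s) (c s') = |s - s'|

/-- The comparison angle between `q` and `r` at `p`: the angle at the vertex corresponding to `p`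
of the Euclidean triangle with the same side lengths. -/
def comparisonAngle {X : Type*} [MetricSpace X] (p q r : X) : ℝ :=
  Real.arccos ((dist p q ^ 2 + dist p r ^ 2 - dist q r ^ 2) / (2 * dist p q * dist p r))

/-- The (upper, Alexandrov) angle between two unit speed geodesics issuing from `c 0 = c' 0`. -/
def upperAngle {X : Type*} [MetricSpace X] (c c' : ℝ → X) : ℝ :=
  limsup (fun t : ℝ × ℝ => comparisonAngle (c 0) (c t.1) (c' t.2)) (𝓝[>] 0 ×ˢ 𝓝[>] 0)

/-! ### Hyperbolic 3-space: the hyperboloid model -/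

/-- Hyperbolic 3-space.  The point with coordinate vector `x` is the point `(√(1 + |x|²), x)` of
the upper sheet of the hyperboloid in Minkowski space `ℝ × ℝ³`. -/
@[ext] structure Hyp3 where
  /-- the space-like coordinates -/
  coord : EuclideanSpace ℝ (Fin 3)

namespace Hyp3

/-- The time coordinate. -/
def time (x : Hyp3) : ℝ := √(1 + ‖x.coord‖ ^ 2)

/-- Minus the Minkowski product. -/
def form (x y : Hyp3) : ℝ := x.time * y.time - inner ℝ x.coord y.coord

lemma time_pos (x : Hyp3) : 0 < x.time := Real.sqrt_pos.2 (by positivity)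

lemma time_sq (x : Hyp3) : x.time ^ 2 = 1 + ‖x.coord‖ ^ 2 := Real.sq_sqrt (by positivity)

lemma form_comm (x y : Hyp3) : x.form y = y.form x := by
  unfold form; rw [real_inner_comm, mul_comm]

lemma one_add_norm_le (x y : Hyp3) : 1 + ‖x.coord‖ * ‖y.coord‖ ≤ x.time * y.time := by
  have h : (x.time * y.time) ^ 2
      = (1 + ‖x.coord‖ * ‖y.coord‖) ^ 2 + (‖x.coord‖ - ‖y.coord‖) ^ 2 := by
    rw [mul_pow, time_sq, time_sq]; ring
  have hx := x.time_pos
  have hy := y.time_pos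
  refine le_of_abs_le (abs_le_of_sq_le_sq ?_ (by positivity))
  rw [h]; nlinarith [sq_nonneg (‖x.coord‖ - ‖y.coord‖)]

lemma one_le_form (x y : Hyp3) : 1 ≤ x.form y := by
  have h1 := one_add_norm_le x y
  have h2 := real_inner_le_norm x.coord y.coord
  unfold form; linarith

lemma form_self (x : Hyp3) : x.form x = 1 := by
  have := time_sq x
  unfold form; rw [real_inner_self_eq_norm_sq]; nlinarith

lemma eq_of_form_eq_one {x y : Hyp3} (h : x.form y = 1) : x = y := by
  have h1 := one_add_norm_le x y
  have h2 := real_inner_le_norm x.coord y.coord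
  have h3 : (x.time * y.time) ^ 2
      = (1 + ‖x.coord‖ * ‖y.coord‖) ^ 2 + (‖x.coord‖ - ‖y.coord‖) ^ 2 := by
    rw [mul_pow, time_sq, time_sq]; ring
  unfold form at h
  have h4 : x.time * y.time = 1 + ‖x.coord‖ * ‖y.coord‖ := by linarith
  have h5 : inner ℝ x.coord y.coord = ‖x.coord‖ * ‖y.coord‖ := by linarith
  rw [h4] at h3
  have h7 : ‖x.coord‖ - ‖y.coord‖ = 0 := by
    have : (‖x.coord‖ - ‖y.coord‖) ^ 2 = 0 := by linarith
    simpa using this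
  have h8 : ‖x.coord - y.coord‖ ^ 2 = 0 := by
    rw [norm_sub_sq_real, h5]; nlinarith
  have h9 : x.coord - y.coord = 0 := by simpa using h8
  exact Hyp3.ext (sub_eq_zero.1 h9)

/-- The coordinates of `x` after the boost that takes `y` to the origin. -/
def boost (y x : Hyp3) : EuclideanSpace ℝ (Fin 3) :=
  x.coord - (x.time - inner ℝ x.coord y.coord / (1 + y.time)) • y.coord

lemma inner_boost (x y z : Hyp3) :
    inner ℝ (boost y x) (boost y z) = x.form y * z.form y - x.form z := by
  have hy : 1 + y.time ≠ 0 := by have := y.time_pos; positivity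
  have h2 : ‖y.coord‖ ^ 2 = y.time ^ 2 - 1 := by rw [time_sq]; ring
  unfold boost form
  simp only [inner_sub_left, inner_sub_right, real_inner_smul_left, real_inner_smul_right,
    real_inner_self_eq_norm_sq, h2]
  rw [real_inner_comm z.coord y.coord]
  field_simp
  ring

instance : Dist Hyp3 := ⟨fun x y => Real.arcosh (x.form y)⟩

lemma dist_def (x y : Hyp3) : dist x y = Real.arcosh (x.form y) := rfl

lemma cosh_dist (x y : Hyp3) : Real.cosh (dist x y) = x.form y :=
  Real.cosh_arcosh (one_le_form x y)

lemma dist_triangle' (x y z : Hyp3) : dist x z ≤ dist x y + dist y z := by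
  have hxy : 0 ≤ dist x y := Real.arcosh_nonneg (one_le_form x y)
  have hyz : 0 ≤ dist y z := Real.arcosh_nonneg (one_le_form y z)
  have hxz : 0 ≤ dist x z := Real.arcosh_nonneg (one_le_form x z)
  have key : Real.cosh (dist x z) ≤ Real.cosh (dist x y + dist y z) := by
    rw [Real.cosh_add, cosh_dist, cosh_dist, cosh_dist, dist_def x y, dist_def y z,
      Real.sinh_arcosh (one_le_form x y), Real.sinh_arcosh (one_le_form y z)]
    have hn : ∀ w : Hyp3, ‖boost y w‖ = √(w.form y ^ 2 - 1) := by
      intro w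
      have := inner_boost w y w
      rw [real_inner_self_eq_norm_sq, form_self] at this
      rw [← pow_two] at this
      rw [← this, Real.sqrt_sq (norm_nonneg _)]
    have h1 := inner_boost x y z
    have h2 := abs_le.1 (abs_real_inner_le_norm (boost y x) (boost y z))
    rw [hn, hn, h1, form_comm z y] at h2
    linarith [h2.1]
  have := Real.cosh_le_cosh.1 key
  rwa [abs_of_nonneg hxz, abs_of_nonneg (by linarith)] at this

instance : MetricSpace Hyp3 where
  dist_self x := by rw [dist_def, form_self, Real.arcosh_zero]
  dist_comm x y := by rw [dist_def, dist_def, form_comm]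
  dist_triangle := dist_triangle'
  eq_of_dist_eq_zero {x y} h :=
    eq_of_form_eq_one ((Real.arcosh_eq_zero_iff (one_le_form x y)).1 h)

/-- Four points are in general position when no totally geodesic plane contains them all, that is,
when the corresponding vectors of Minkowski space are linearly independent. -/
def GeneralPosition (p : Fin 4 → Hyp3) : Prop :=
  LinearIndependent ℝ fun i => ((p i).time, (p i).coord)

end Hyp3

/-! ### General hyperbolic 3-manifolds -/

/-- A chart of `M` with values in hyperbolic 3-space: a topological embedding of an open subset of
`M` (near a boundary point of `M` the image need not be open). -/
structure HypChart (M : Type*) [TopologicalSpace M] where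
  source : Set M
  isOpen_source : IsOpen source
  toFun : M → Hyp3
  isEmbedding : IsEmbedding (source.domRestrict toFun)

/-- The map `f : X → M`, read in charts of the atlas `A`, preserves distances locally on `S`. -/
def IsLocalChartIsometryOn {M : Type*} [TopologicalSpace M] (A : Set (HypChart M))
    {X : Type*} [MetricSpace X] (f : X → M) (S : Set X) : Prop :=
  ∀ x ∈ S, ∃ φ ∈ A, ∃ W ∈ 𝓝 x, (∀ y ∈ W ∩ S, f y ∈ φ.source) ∧
    ∀ y ∈ W ∩ S, ∀ z ∈ W ∩ S, dist (φ.toFun (f y)) (φ.toFun (f z)) = dist y z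

/-- A locally finite triangulation of `M` by hyperbolic tetrahedra meeting face to face. -/
structure HypTriangulation {M : Type*} [TopologicalSpace M] (A : Set (HypChart M)) where
  ι : Type
  vertex : ι → Fin 4 → Hyp3
  generalPosition : ∀ i, Hyp3.GeneralPosition (vertex i)
  toFun : ι → Hyp3 → M
  injOn : ∀ i, InjOn (toFun i) (geodHull (range (vertex i)))
  isometric : ∀ i, IsLocalChartIsometryOn A (toFun i) (geodHull (range (vertex i)))
  cover : ⋃ i, toFun i '' geodHull (range (vertex i)) = univ
  locallyFinite : LocallyFinite fun i => toFun i '' geodHull (range (vertex i))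
  faceToFace : ∀ i j, i ≠ j → ∃ S T : Set (Fin 4), S ≠ univ ∧ T ≠ univ ∧
    toFun i '' geodHull (range (vertex i)) ∩ toFun j '' geodHull (range (vertex j))
      = toFun i '' geodHull (vertex i '' S) ∧
    toFun i '' geodHull (vertex i '' S) = toFun j '' geodHull (vertex j '' T)

/-- A general hyperbolic 3-manifold: a 3-manifold with (possibly empty) boundary, with charts to
hyperbolic 3-space whose transition maps are restrictions of isometries, which is complete for
the length metric induced by the charts and has a triangulation by hyperbolic tetrahedra.
No convexity is required of the chart images. -/
structure GeneralHyperbolicManifold (M : Type*) [MetricSpace M] where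
  atlas : Set (HypChart M)
  /-- `M` is a topological 3-manifold with boundary. -/
  manifold : ∀ x : M, ∃ e : OpenPartialHomeomorph M (EuclideanHalfSpace 3), x ∈ e.source
  cover : ∀ x : M, ∃ φ ∈ atlas, x ∈ φ.source
  transition : ∀ φ ∈ atlas, ∀ ψ ∈ atlas, ∀ x ∈ φ.source ∩ ψ.source,
    ∃ g : Hyp3 ≃ᵢ Hyp3, ∀ᶠ y in 𝓝 x, ψ.toFun y = g (φ.toFun y)
  /-- Lengths of paths are the hyperbolic lengths measured in the charts, ... -/
  length_chart : ∀ φ ∈ atlas, ∀ (x y : M) (γ : Path x y), (∀ t, γ t ∈ φ.source) →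
    eVariationOn (fun t => γ t) univ = eVariationOn (fun t => φ.toFun (γ t)) univ
  /-- ... and distances are infima of lengths of paths. -/
  length_metric : ∀ x y : M, edist x y = ⨅ γ : Path x y, eVariationOn (fun t => γ t) univ
  complete : CompleteSpace M
  triangulation : Nonempty (HypTriangulation atlas)

/-! ### Compact triangulated surfaces -/

/-- A directed side of one of the triangles indexed by `F`: the side from corner `a` to corner `b`
of the triangle `t`.  It also encodes a corner together with one of the two sides at it. -/
@[ext] structure Side (F : Type*) where
  t : F
  a : Fin 3
  b : Fin 3
  ne : a ≠ b

/-- The same side with the opposite direction. -/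
def Side.rev {F : Type*} (d : Side F) : Side F := ⟨d.t, d.b, d.a, d.ne.symm⟩

/-- The initial corner of a directed side. -/
def Side.corner {F : Type*} (d : Side F) : F × Fin 3 := (d.t, d.a)

/-- A triangulated surface (possibly disconnected, possibly with boundary) with the triangles
indexed by `F`, as a gluing of sides in pairs.  `glue` maps a directed side to the one it is
identified with; the sides with `glue d = d` are not glued, and form the boundary. Several
sides or corners of one triangle may become identified. -/
structure TriSurface (F : Type*) where
  glue : Side F → Side F
  glue_glue : ∀ d, glue (glue d) = d
  glue_rev : ∀ d, glue d.rev = (glue d).rev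
  /-- no side is folded onto itself -/
  glue_ne_rev : ∀ d, glue d ≠ d.rev

namespace TriSurface

variable {F : Type*} (K : TriSurface F)

/-- The vertices of the surface: corners of triangles, up to the identifications by gluing. -/
def Vertex : Type _ :=
  Quot fun c c' : F × Fin 3 => ∃ d : Side F, d.corner = c ∧ (K.glue d).corner = c'

/-- The edges of the surface: undirected sides of triangles, up to gluing. -/
def Edge : Type _ := Quot fun d d' : Side F => d' = d.rev ∨ d' = K.glue d

/-- The vertex of the surface at a corner. -/
def vertexAt (c : F × Fin 3) : K.Vertex := Quot.mk _ c

/-- Boundary sides. -/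
def IsBoundary (d : Side F) : Prop := K.glue d = d

/-- The directed boundary sides issuing from the vertex `v`. -/
def boundaryAt (v : K.Vertex) : Set (Side F) := {d | K.IsBoundary d ∧ K.vertexAt d.corner = v}

/-- Vertices on the boundary of the surface. -/
def IsBoundaryVertex (v : K.Vertex) : Prop := (K.boundaryAt v).Nonempty

/-- The Euler characteristic. -/
def eulerChar [Fintype F] : ℤ := (Nat.card K.Vertex : ℤ) - Nat.card K.Edge + Fintype.card F

/-- The underlying topological space: a disjoint union of 2-simplices with the sides glued
affinely. -/
def Realization : Type _ :=
  Quot fun x y : (Σ _ : F, stdSimplex ℝ (Fin 3)) => ∃ d : Side F, ∃ s ∈ Icc (0 : ℝ) 1,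
    x.1 = d.t ∧
    (x.2 : Fin 3 → ℝ) = (1 - s) • Pi.single d.a 1 + s • Pi.single d.b 1 ∧
    y.1 = (K.glue d).t ∧
    (y.2 : Fin 3 → ℝ) = (1 - s) • Pi.single (K.glue d).a 1 + s • Pi.single (K.glue d).b 1

instance : TopologicalSpace K.Realization := inferInstanceAs (TopologicalSpace (Quot _))

/-- The surface is a closed disk. -/
def IsDisk : Prop :=
  Nonempty (K.Realization ≃ₜ Metric.closedBall (0 : EuclideanSpace ℝ (Fin 2)) 1)

end TriSurface

/-! ### Triangulated maps and h-maps -/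

/-- The point at distance `s` from `x` on the geodesic of the hyperbolic plane from `x` to `y`
(meaningful for `0 ≤ s ≤ dist x y`). -/
def geodPoint (x y : ℍ) (s : ℝ) : ℍ :=
  Classical.epsilon fun z => dist x z = s ∧ dist z y = dist x y - s

/-- A map from a triangulated surface to a general hyperbolic manifold that maps each triangle to
a totally geodesic hyperbolic triangle, together with the hyperbolic structure that it induces
on the triangles.  The triangle `t` is given by its vertices in the hyperbolic plane, and its map
to `M` preserves distances locally, as read in the charts.  The three vertices may lie on a
geodesic, but they are distinct. -/
structure TriangulatedMap {F : Type*} (K : TriSurface F) {M : Type*} [MetricSpace M]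
    (H : GeneralHyperbolicManifold M) where
  vertex : F → Fin 3 → ℍ
  injective : ∀ t, Function.Injective (vertex t)
  toFun : F → ℍ → M
  isometric : ∀ t, IsLocalChartIsometryOn H.atlas (toFun t) (geodHull (range (vertex t)))
  /-- Sides that are glued have the same length ... -/
  glue_length : ∀ d : Side F, dist (vertex (K.glue d).t (K.glue d).a)
    (vertex (K.glue d).t (K.glue d).b) = dist (vertex d.t d.a) (vertex d.t d.b)
  /-- ... and the maps of the triangles agree on them. -/
  glue_map : ∀ d : Side F, ∀ s ∈ Icc 0 (dist (vertex d.t d.a) (vertex d.t d.b)),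
    toFun (K.glue d).t (geodPoint (vertex (K.glue d).t (K.glue d).a)
        (vertex (K.glue d).t (K.glue d).b) s)
      = toFun d.t (geodPoint (vertex d.t d.a) (vertex d.t d.b) s)

namespace TriangulatedMap

variable {F : Type*} {K : TriSurface F} {M : Type*} [MetricSpace M]
  {H : GeneralHyperbolicManifold M} (f : TriangulatedMap K H)

/-- The length of a side. -/
def sideLength (d : Side F) : ℝ := dist (f.vertex d.t d.a) (f.vertex d.t d.b)

/-- The image in `M` of a directed side, parametrized by arc length. -/
def sidePath (d : Side F) (s : ℝ) : M :=
  f.toFun d.t (geodPoint (f.vertex d.t d.a) (f.vertex d.t d.b) s)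

/-- The path in `M` that runs along `d` to its initial corner and then along `d'`; at the time `0`
it is at the corner. -/
def turnPath (d d' : Side F) (s : ℝ) : M := if s ≤ 0 then f.sidePath d (-s) else f.sidePath d' s

/-- The angle of a hyperbolic triangle at a corner. -/
def cornerAngle (c : F × Fin 3) : ℝ :=
  upperAngle (geodPoint (f.vertex c.1 c.2) (f.vertex c.1 (c.2 + 1)))
    (geodPoint (f.vertex c.1 c.2) (f.vertex c.1 (c.2 + 2)))

open Classical in
/-- The sum of the angles of the triangles around a vertex. -/
def angleSum [Fintype F] (v : K.Vertex) : ℝ :=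
  ∑ c : F × Fin 3, if K.vertexAt c = v then f.cornerAngle c else 0

/-- The area of the surface in the induced hyperbolic structure: the sum of the hyperbolic areas
of the triangles. -/
def area [Fintype F] : ℝ := ∑ t : F, (volume (geodHull (range (f.vertex t)))).toReal

/-- h-maps relative to a set `D` of distinguished boundary vertices. -/
def IsHMap [Fintype F] (D : Set K.Vertex) : Prop :=
  (∀ v, ¬ K.IsBoundaryVertex v → 2 * π ≤ f.angleSum v) ∧
    ∀ v, K.IsBoundaryVertex v → v ∉ D → π ≤ f.angleSum v

/-- Each component of the boundary minus the vertices in `D` is mapped to a (local) geodesic of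
`M`: the boundary sides are, and so are their concatenations at the vertices not in `D`. -/
def HasGeodesicBoundary (D : Set K.Vertex) : Prop :=
  (∀ d, K.IsBoundary d → IsLocalGeodesicOn (f.sidePath d) (Icc 0 (f.sideLength d))) ∧
    ∀ v, v ∉ D → ∀ d ∈ K.boundaryAt v, ∀ d' ∈ K.boundaryAt v, d ≠ d' →
      IsLocalGeodesicOn (f.turnPath d d') (Icc (-f.sideLength d) (f.sideLength d'))

/-- The exterior angle in `M` between the boundary sides `d` and `d'` that meet at a vertex. -/
def exteriorAngle (d d' : Side F) : ℝ := π - upperAngle (f.sidePath d) (f.sidePath d')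

end TriangulatedMap

end GH

end

/-!
The inequality is the Gauss–Bonnet formula of the surface, with an inequality at every vertex.

*Triangles.* The area of a hyperbolic triangle is at most `π` minus the sum of its angles
(`areaBound`; only this direction is needed). The angles of the law of cosines, `hypAngle`, bound
the Alexandrov angles from above, because Euclidean comparison angles decrease to them
(`upperAngle_geodPoint_le`). For the area, a Möbius transformation makes one side vertical; the
triangle is contained in the region between two circular arcs, and the integral of `1 / y` along an
arc is a difference of Euclidean angles (`areaBound_vertical`).

*Summation.* With `V`, `E`, `F` vertices, edges and triangles, and `B` directed boundary sides,
`4 E = 6 F + B`. At each vertex the number of boundary sides is even, so there are at most `B / 2`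
boundary vertices. Adding the bounds for the triangles and using the angle conditions of an h-map
gives the inequality with the exterior angles of the surface
(`TriangulatedMap.area_le_sum_sub_angleSum`).

*Angles in the manifold.* Close to a corner the map of a triangle preserves the distances of `M`,
since these are infima of lengths of paths, and short paths stay in a chart
(`exists_dist_eq_of_isLocalChartIsometryOn`). Turning around a vertex from one boundary side to the
other crosses every triangle at most once, so the triangle inequality for upper angles
(`upperAngle_triangle`) shows that the angle in `M` is at most the angle in the surface
(`TriangulatedMap.upperAngle_le_angleSum`). This gives the inequality for the angles of `M`.

*Disks.* An integral 1-cocycle of the surface defines a map from its realization to the circle. On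
a disk this map lifts to the line, so the cocycle is a coboundary. Comparing dimensions of rational
cochains, `E - F ≤ V - 1`, that is, the Euler characteristic is at least `1`
(`TriSurface.IsDisk.one_le_eulerChar`). As the exterior angles are at most `π`, the bound
`(n - 2) π` follows.
-/

noncomputable section

namespace GH

/-! ### The hyperbolic plane in Minkowski coordinates -/

/-- The Minkowski vector of a point of the hyperbolic plane, in the null coordinates
`(|z|² / y, x / y, 1 / y)`, in which the Minkowski form is `lorentzForm`. -/
def lorentzVec (z : ℍ) : ℝ × ℝ × ℝ :=
  ((z.re ^ 2 + z.im ^ 2) / z.im, z.re / z.im, 1 / z.im)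

/-- Minus the Minkowski product, in null coordinates. -/
def lorentzForm (u v : ℝ × ℝ × ℝ) : ℝ := (u.1 * v.2.2 + u.2.2 * v.1) / 2 - u.2.1 * v.2.1

lemma lorentzForm_comm (u v : ℝ × ℝ × ℝ) : lorentzForm u v = lorentzForm v u := by
  unfold lorentzForm; ring

lemma lorentzForm_add_left (u v w : ℝ × ℝ × ℝ) :
    lorentzForm (u + v) w = lorentzForm u w + lorentzForm v w := by
  simp only [lorentzForm, Prod.fst_add, Prod.snd_add]; ring

lemma lorentzForm_smul_left (a : ℝ) (u w : ℝ × ℝ × ℝ) :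
    lorentzForm (a • u) w = a * lorentzForm u w := by
  simp only [lorentzForm, Prod.smul_fst, Prod.smul_snd, smul_eq_mul]; ring

lemma lorentzForm_add_right (u v w : ℝ × ℝ × ℝ) :
    lorentzForm w (u + v) = lorentzForm w u + lorentzForm w v := by
  simp only [lorentzForm, Prod.fst_add, Prod.snd_add]; ring

lemma lorentzForm_smul_right (a : ℝ) (u w : ℝ × ℝ × ℝ) :
    lorentzForm w (a • u) = a * lorentzForm w u := by
  simp only [lorentzForm, Prod.smul_fst, Prod.smul_snd, smul_eq_mul]; ring

lemma cosh_dist_eq_lorentzForm (x y : ℍ) :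
    Real.cosh (dist x y) = lorentzForm (lorentzVec x) (lorentzVec y) := by
  have hx := x.im_ne_zero
  have hy := y.im_ne_zero
  rw [UpperHalfPlane.cosh_dist']
  simp only [lorentzForm, lorentzVec]
  field_simp
  ring

lemma lorentzForm_self (x : ℍ) : lorentzForm (lorentzVec x) (lorentzVec x) = 1 := by
  rw [← cosh_dist_eq_lorentzForm, dist_self, Real.cosh_zero]

/-- A null vector orthogonal to a time-like one is zero. -/
lemma eq_zero_of_lorentzForm {w : ℝ × ℝ × ℝ} {x : ℍ} (h : lorentzForm w (lorentzVec x) = 0)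
    (hw : lorentzForm w w = 0) : w = 0 := by
  have h1 := lorentzForm_self x
  have hpos : 0 < (lorentzVec x).2.2 := one_div_pos.2 x.im_pos
  obtain ⟨a, b, c⟩ := w
  generalize lorentzVec x = u at *
  obtain ⟨p, q, r⟩ := u
  simp only [lorentzForm] at h h1 hw hpos
  have e1 : a * r + c * p = 2 * b * q := by linarith
  have e2 : a * c = b ^ 2 := by linarith
  have e3 : p * r = 1 + q ^ 2 := by linarith
  have e4 : (a * r - c * p) ^ 2 = -4 * b ^ 2 := by
    have : (a * r - c * p) ^ 2 = (a * r + c * p) ^ 2 - 4 * (a * c) * (p * r) := by ring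
    rw [this, e1, e2, e3]; ring
  have hb : b = 0 := by
    have : b ^ 2 = 0 := by nlinarith [sq_nonneg (a * r - c * p), sq_nonneg b]
    simpa using this
  have hp : 0 < p := by nlinarith [sq_nonneg q]
  subst hb
  have e5 : a * r - c * p = 0 := by simpa using e4
  have e6 : a * r + c * p = 0 := by simpa using e1
  have ha : a = 0 := by
    have : a * r = 0 := by linarith
    rcases mul_eq_zero.1 this with h | h
    · exact h
    · exact absurd h hpos.ne'
  have hc : c = 0 := by
    have : c * p = 0 := by linarith
    rcases mul_eq_zero.1 this with h | h
    · exact h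
    · exact absurd h hp.ne'
  rw [ha, hc]; rfl

/-- The Minkowski vector at distance `s` on the geodesic from `x` to `y`. -/
def geodVec (x y : ℍ) (s : ℝ) : ℝ × ℝ × ℝ :=
  (Real.sinh (dist x y - s) / Real.sinh (dist x y)) • lorentzVec x +
    (Real.sinh s / Real.sinh (dist x y)) • lorentzVec y

lemma sinh_dist_pos {x y : ℍ} (h : x ≠ y) : 0 < Real.sinh (dist x y) :=
  Real.sinh_pos_iff.2 (dist_pos.2 h)

/-- A point on a shortest geodesic from `x` to `y` is a positive combination of `x` and `y`:
the difference is null and orthogonal to `x`. -/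
lemma lorentzVec_eq_geodVec {x y z : ℍ} (hxy : x ≠ y) (h : dist x z + dist z y = dist x y) :
    lorentzVec z = geodVec x y (dist x z) := by
  have hS := sinh_dist_pos hxy
  have hy : dist x y - dist x z = dist z y := by linarith
  unfold geodVec
  rw [hy]
  set a := dist x z
  set b := dist z y
  set S := Real.sinh (dist x y) with hSdef
  have hSab : S = Real.sinh a * Real.cosh b + Real.cosh a * Real.sinh b := by
    rw [hSdef, ← h, Real.sinh_add]
  have hCab : lorentzForm (lorentzVec x) (lorentzVec y)
      = Real.cosh a * Real.cosh b + Real.sinh a * Real.sinh b := by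
    rw [← cosh_dist_eq_lorentzForm, ← h, Real.cosh_add]
  have hxz : lorentzForm (lorentzVec x) (lorentzVec z) = Real.cosh a :=
    (cosh_dist_eq_lorentzForm x z).symm
  have hzy : lorentzForm (lorentzVec z) (lorentzVec y) = Real.cosh b :=
    (cosh_dist_eq_lorentzForm z y).symm
  have ha := Real.cosh_sq a
  have hb := Real.cosh_sq b
  rw [← sub_eq_zero]
  apply eq_zero_of_lorentzForm (x := x)
  · rw [sub_eq_add_neg, ← neg_one_smul ℝ (_ + _), lorentzForm_comm]
    simp only [lorentzForm_add_right, lorentzForm_smul_right, lorentzForm_self, hxz, hCab]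
    field_simp
    rw [hSab]
    linear_combination Real.sinh b * ha
  · rw [sub_eq_add_neg, ← neg_one_smul ℝ (_ + _)]
    simp only [lorentzForm_add_left, lorentzForm_smul_left, lorentzForm_self,
      lorentzForm_add_right, lorentzForm_smul_right, lorentzForm_comm (lorentzVec z) (lorentzVec x),
      lorentzForm_comm (lorentzVec y) _, hxz, hCab, hzy]
    field_simp
    rw [hSab]
    generalize Real.sinh a = sa at *
    generalize Real.sinh b = sb at *
    generalize Real.cosh a = ca at *
    generalize Real.cosh b = cb at *
    linear_combination (-sb ^ 2) * ha + (-sa ^ 2) * hb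

lemma exists_lorentzVec_eq {u : ℝ × ℝ × ℝ} (h : lorentzForm u u = 1) (hpos : 0 < u.2.2) :
    ∃ z : ℍ, lorentzVec z = u := by
  obtain ⟨a, b, c⟩ := u
  simp only [lorentzForm] at h hpos
  have hc := hpos.ne'
  refine ⟨⟨⟨b / c, 1 / c⟩, one_div_pos.2 hpos⟩, ?_⟩
  have e : a * c = 1 + b ^ 2 := by linarith
  simp only [lorentzVec, UpperHalfPlane.mk_re, UpperHalfPlane.mk_im, Prod.mk.injEq]
  refine ⟨?_, ?_, ?_⟩
  · field_simp; linarith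
  · field_simp
  · field_simp

lemma lorentzForm_geodVec_self {x y : ℍ} (hxy : x ≠ y) (s : ℝ) :
    lorentzForm (geodVec x y s) (geodVec x y s) = 1 := by
  have hS := (sinh_dist_pos hxy).ne'
  have hc := Real.cosh_sq (dist x y)
  have hs := Real.cosh_sq s
  unfold geodVec
  simp only [lorentzForm_add_left, lorentzForm_smul_left, lorentzForm_self,
      lorentzForm_add_right, lorentzForm_smul_right, lorentzForm_comm (lorentzVec y) (lorentzVec x),
      ← cosh_dist_eq_lorentzForm, Real.sinh_sub]
  field_simp
  generalize Real.sinh (dist x y) = sa at *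
  generalize Real.sinh s = sb at *
  generalize Real.cosh (dist x y) = ca at *
  generalize Real.cosh s = cb at *
  linear_combination (-sb ^ 2) * hc + (sa ^ 2) * hs

lemma lorentzForm_geodVec {x y : ℍ} (hxy : x ≠ y) (s : ℝ) :
    lorentzForm (lorentzVec x) (geodVec x y s) = Real.cosh s := by
  have hS := (sinh_dist_pos hxy).ne'
  unfold geodVec
  simp only [lorentzForm_self, lorentzForm_add_right, lorentzForm_smul_right,
      ← cosh_dist_eq_lorentzForm, Real.sinh_sub]
  field_simp
  ring

lemma geodVec_symm (x y : ℍ) (s : ℝ) : geodVec x y s = geodVec y x (dist x y - s) := by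
  unfold geodVec
  rw [dist_comm y x, sub_sub_cancel, add_comm]

lemma geodPoint_spec {x y : ℍ} {s : ℝ} (hs : s ∈ Icc 0 (dist x y)) :
    dist x (geodPoint x y s) = s ∧ dist (geodPoint x y s) y = dist x y - s := by
  apply Classical.epsilon_spec (p := fun z => dist x z = s ∧ dist z y = dist x y - s)
  rcases eq_or_ne x y with rfl | hxy
  · rw [dist_self] at hs ⊢
    have : s = 0 := le_antisymm hs.2 hs.1
    subst this
    exact ⟨x, by simp⟩
  have hS := sinh_dist_pos hxy
  obtain ⟨z, hz⟩ := exists_lorentzVec_eq (lorentzForm_geodVec_self hxy s) (by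
    have h1 : 0 ≤ Real.sinh (dist x y - s) := Real.sinh_nonneg_iff.2 (by linarith [hs.2])
    have h2 : 0 ≤ Real.sinh s := Real.sinh_nonneg_iff.2 hs.1
    have hx := x.im_pos
    have hy := y.im_pos
    simp only [geodVec, lorentzVec, Prod.snd_add, Prod.smul_snd, smul_eq_mul]
    rcases hs.1.eq_or_lt with h | h
    · rw [← h]; simp only [sub_zero, Real.sinh_zero]; rw [div_self hS.ne']; simp [hx]
    · have h2 : 0 < Real.sinh s := Real.sinh_pos_iff.2 h
      positivity)
  refine ⟨z, ?_, ?_⟩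
  · have : Real.cosh (dist x z) = Real.cosh s := by
      rw [cosh_dist_eq_lorentzForm, hz, lorentzForm_geodVec hxy]
    exact Real.cosh_injOn (mem_Ici.2 dist_nonneg) (mem_Ici.2 hs.1) this
  · have : Real.cosh (dist y z) = Real.cosh (dist x y - s) := by
      rw [cosh_dist_eq_lorentzForm, hz, geodVec_symm, lorentzForm_geodVec hxy.symm]
    rw [dist_comm]
    exact Real.cosh_injOn (mem_Ici.2 dist_nonneg) (mem_Ici.2 (sub_nonneg.2 hs.2)) this

lemma lorentzVec_geodPoint {x y : ℍ} (hxy : x ≠ y) {s : ℝ} (hs : s ∈ Icc 0 (dist x y)) :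
    lorentzVec (geodPoint x y s) = geodVec x y s := by
  obtain ⟨h1, h2⟩ := geodPoint_spec hs
  rw [lorentzVec_eq_geodVec hxy (by linarith), h1]

lemma geodPoint_zero (x y : ℍ) : geodPoint x y 0 = x := by
  have := (geodPoint_spec (x := x) (y := y) (s := 0) ⟨le_rfl, dist_nonneg⟩).1
  exact (dist_eq_zero.1 this).symm

lemma geodPoint_mem_geodSegment {x y : ℍ} {s : ℝ} (hs : s ∈ Icc 0 (dist x y)) :
    geodPoint x y s ∈ geodSegment x y := by
  obtain ⟨h1, h2⟩ := geodPoint_spec hs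
  show _ + _ = _
  linarith

/-- The cosine of the angle at `p` of the hyperbolic triangle `p`, `q`, `r`, by the hyperbolic law
of cosines. -/
def hypCos (p q r : ℍ) : ℝ :=
  (Real.cosh (dist p q) * Real.cosh (dist p r) - Real.cosh (dist q r)) /
    (Real.sinh (dist p q) * Real.sinh (dist p r))

/-- The angle at `p` of the hyperbolic triangle `p`, `q`, `r`. -/
def hypAngle (p q r : ℍ) : ℝ := Real.arccos (hypCos p q r)

lemma cosh_dist_geodPoint {p q r : ℍ} (hq : p ≠ q) (hr : p ≠ r) {s t : ℝ}
    (hs : s ∈ Icc 0 (dist p q)) (ht : t ∈ Icc 0 (dist p r)) :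
    Real.cosh (dist (geodPoint p q s) (geodPoint p r t))
      = Real.cosh s * Real.cosh t - Real.sinh s * Real.sinh t * hypCos p q r := by
  have hS := (sinh_dist_pos hq).ne'
  have hT := (sinh_dist_pos hr).ne'
  rw [cosh_dist_eq_lorentzForm, lorentzVec_geodPoint hq hs, lorentzVec_geodPoint hr ht]
  unfold geodVec hypCos
  simp only [lorentzForm_add_left, lorentzForm_smul_left, lorentzForm_self,
      lorentzForm_add_right, lorentzForm_smul_right, lorentzForm_comm (lorentzVec q) (lorentzVec p),
      ← cosh_dist_eq_lorentzForm, Real.sinh_sub]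
  field_simp
  ring

lemma hypCos_self {p q : ℍ} (hq : p ≠ q) : hypCos p q q = 1 := by
  have hS := (sinh_dist_pos hq).ne'
  unfold hypCos
  rw [dist_self, Real.cosh_zero, ← pow_two, ← pow_two, Real.cosh_sq, add_sub_cancel_right,
    div_self (pow_ne_zero 2 hS)]

lemma dist_geodPoint {p q : ℍ} {s t : ℝ}
    (hs : s ∈ Icc 0 (dist p q)) (ht : t ∈ Icc 0 (dist p q)) :
    dist (geodPoint p q s) (geodPoint p q t) = |s - t| := by
  rcases eq_or_ne p q with rfl | hq
  · rw [dist_self] at hs ht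
    rw [le_antisymm hs.2 hs.1, le_antisymm ht.2 ht.1]; simp
  have := cosh_dist_geodPoint hq hq hs ht
  rw [hypCos_self hq, mul_one, ← Real.cosh_sub, ← Real.cosh_abs (s - t)] at this
  exact Real.cosh_injOn (mem_Ici.2 dist_nonneg) (mem_Ici.2 (abs_nonneg (s - t))) this

lemma hypCos_comm (p q r : ℍ) : hypCos p q r = hypCos p r q := by
  unfold hypCos; rw [dist_comm q r]; ring

lemma hypAngle_comm (p q r : ℍ) : hypAngle p q r = hypAngle p r q := by
  unfold hypAngle; rw [hypCos_comm]

lemma hypCos_le_one {p q r : ℍ} (hq : p ≠ q) (hr : p ≠ r) : hypCos p q r ≤ 1 := by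
  have hS := sinh_dist_pos hq
  have hT := sinh_dist_pos hr
  unfold hypCos
  rw [div_le_one (by positivity)]
  have : Real.cosh (dist p q - dist p r) ≤ Real.cosh (dist q r) := by
    rw [Real.cosh_le_cosh, abs_of_nonneg (dist_nonneg (x := q)), abs_le]
    constructor <;> linarith [dist_triangle p q r, dist_triangle p r q, dist_comm q r]
  rw [Real.cosh_sub] at this
  linarith

/-- Comparison with the Euclidean plane: `x² / 2 - cosh x` is decreasing for `x ≥ 0`. -/
lemma sq_sub_sq_le_cosh_sub_cosh {x y : ℝ} (h : |x| ≤ y) :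
    y ^ 2 - x ^ 2 ≤ 2 * (Real.cosh y - Real.cosh x) := by
  have hanti : MonotoneOn (fun u : ℝ => 2 * Real.cosh u - u ^ 2) (Ici 0) := by
    apply monotoneOn_of_deriv_nonneg (convex_Ici 0)
    · fun_prop
    · fun_prop
    · intro u hu
      rw [interior_Ici] at hu
      have : HasDerivAt (fun u : ℝ => 2 * Real.cosh u - u ^ 2) (2 * Real.sinh u - 2 * u) u := by
        convert! ((Real.hasDerivAt_cosh u).const_mul 2).sub (hasDerivAt_pow 2 u) using 1
        simp
      rw [this.deriv]
      linarith [(Real.self_le_sinh_iff (x := u)).2 (le_of_lt hu)]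
  have := hanti (abs_nonneg x) (mem_Ici.2 ((abs_nonneg x).trans h)) h
  simp only [Real.cosh_abs, sq_abs] at this
  linarith

lemma tendsto_sinh_div : Tendsto (fun s : ℝ => Real.sinh s / s) (𝓝[>] 0) (𝓝 1) := by
  have h := (Real.hasDerivAt_sinh 0).tendsto_slope_zero
  simp only [zero_add, Real.sinh_zero, sub_zero, Real.cosh_zero, smul_eq_mul] at h
  refine (h.mono_left (nhdsWithin_mono _ fun s hs => ne_of_gt hs)).congr fun s => ?_
  rw [div_eq_inv_mul]

lemma comparisonAngle_nonneg {X : Type*} [MetricSpace X] (p q r : X) :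
    0 ≤ comparisonAngle p q r := Real.arccos_nonneg _

lemma comparisonAngle_le_pi {X : Type*} [MetricSpace X] (p q r : X) :
    comparisonAngle p q r ≤ π := Real.arccos_le_pi _

lemma isBoundedUnder_comparisonAngle {X ι : Type*} [MetricSpace X] (l : Filter ι) (p q r : ι → X) :
    l.IsBoundedUnder (· ≤ ·) fun t => comparisonAngle (p t) (q t) (r t) :=
  isBoundedUnder_of ⟨π, fun _ => comparisonAngle_le_pi _ _ _⟩

lemma isCoboundedUnder_comparisonAngle {X ι : Type*} [MetricSpace X] (l : Filter ι) [l.NeBot]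
    (p q r : ι → X) :
    l.IsCoboundedUnder (· ≤ ·) fun t => comparisonAngle (p t) (q t) (r t) :=
  (isBoundedUnder_of ⟨0, fun _ => comparisonAngle_nonneg _ _ _⟩ :
    l.IsBoundedUnder (· ≥ ·) _).isCoboundedUnder_le

lemma upperAngle_nonneg {X : Type*} [MetricSpace X] (c c' : ℝ → X) : 0 ≤ upperAngle c c' := by
  refine le_limsup_of_frequently_le (Frequently.of_forall fun _ => comparisonAngle_nonneg _ _ _) ?_
  exact isBoundedUnder_comparisonAngle _ _ _ _

lemma upperAngle_le_pi {X : Type*} [MetricSpace X] (c c' : ℝ → X) : upperAngle c c' ≤ π := by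
  refine limsup_le_of_le ?_ (Eventually.of_forall fun _ => comparisonAngle_le_pi _ _ _)
  exact isCoboundedUnder_comparisonAngle _ _ _ _

/-- The Alexandrov angle of two sides of a hyperbolic triangle is at most the angle of the law of
cosines.  (They are equal; the Euclidean comparison angles decrease to it.) -/
lemma upperAngle_geodPoint_le {p q r : ℍ} (hq : p ≠ q) (hr : p ≠ r) :
    upperAngle (geodPoint p q) (geodPoint p r) ≤ hypAngle p q r := by
  set k := 1 - hypCos p q r with hk
  have hk0 : 0 ≤ k := by linarith [hypCos_le_one hq hr]
  have key : ∀ᶠ t : ℝ × ℝ in 𝓝[>] 0 ×ˢ 𝓝[>] 0,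
      comparisonAngle (geodPoint p q 0) (geodPoint p q t.1) (geodPoint p r t.2)
        ≤ Real.arccos (1 - k * (Real.sinh t.1 / t.1) * (Real.sinh t.2 / t.2)) := by
    have e1 : ∀ᶠ s : ℝ in 𝓝[>] 0, s ∈ Ioc 0 (dist p q) := Ioc_mem_nhdsGT (dist_pos.2 hq)
    have e2 : ∀ᶠ s : ℝ in 𝓝[>] 0, s ∈ Ioc 0 (dist p r) := Ioc_mem_nhdsGT (dist_pos.2 hr)
    filter_upwards [e1.prod_mk e2] with ⟨s, t⟩ ⟨hs, ht⟩
    simp only at hs ht ⊢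
    have hs' : s ∈ Icc 0 (dist p q) := ⟨hs.1.le, hs.2⟩
    have ht' : t ∈ Icc 0 (dist p r) := ⟨ht.1.le, ht.2⟩
    have hs0 := hs.1
    have ht0 := ht.1
    unfold comparisonAngle
    apply Real.arccos_le_arccos
    rw [geodPoint_zero, (geodPoint_spec hs').1, (geodPoint_spec ht').1]
    have hc := cosh_dist_geodPoint hq hr hs' ht'
    set D := dist (geodPoint p q s) (geodPoint p r t)
    have hab : |s - t| ≤ D := by
      have h1 := dist_triangle p (geodPoint p q s) (geodPoint p r t)
      have h2 := dist_triangle p (geodPoint p r t) (geodPoint p q s)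
      rw [(geodPoint_spec hs').1, (geodPoint_spec ht').1] at h1 h2
      rw [dist_comm (geodPoint p r t)] at h2
      rw [abs_le]; constructor <;> linarith
    have h := sq_sub_sq_le_cosh_sub_cosh hab
    rw [hc, Real.cosh_sub] at h
    rw [le_div_iff₀ (by positivity)]
    have e : (1 - k * (Real.sinh s / s) * (Real.sinh t / t)) * (2 * s * t)
        = 2 * s * t - 2 * k * Real.sinh s * Real.sinh t := by field_simp
    rw [e, hk]
    nlinarith
  have hlim : Tendsto (fun t : ℝ × ℝ =>
      Real.arccos (1 - k * (Real.sinh t.1 / t.1) * (Real.sinh t.2 / t.2)))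
      (𝓝[>] 0 ×ˢ 𝓝[>] 0) (𝓝 (hypAngle p q r)) := by
    have e : hypAngle p q r = Real.arccos (1 - k * 1 * 1) := by rw [hk, hypAngle]; congr 1; ring
    rw [e]
    refine (Real.continuous_arccos.tendsto _).comp ?_
    exact tendsto_const_nhds.sub ((tendsto_const_nhds.mul
      (tendsto_sinh_div.comp tendsto_fst)).mul (tendsto_sinh_div.comp tendsto_snd))
  unfold upperAngle
  rw [← hlim.limsup_eq]
  exact limsup_le_limsup key (isCoboundedUnder_comparisonAngle _ _ _ _) hlim.isBoundedUnder_le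

/-- Half-planes are convex. -/
lemma geodConvex_halfPlane (a b c : ℝ) :
    GeodConvex {z : ℍ | 0 ≤ a * (z.re ^ 2 + z.im ^ 2) + b * z.re + c} := by
  have key : ∀ z : ℍ, 0 ≤ a * (z.re ^ 2 + z.im ^ 2) + b * z.re + c ↔
      0 ≤ a * (lorentzVec z).1 + b * (lorentzVec z).2.1 + c * (lorentzVec z).2.2 := by
    intro z
    have hz := z.im_pos
    have : a * (lorentzVec z).1 + b * (lorentzVec z).2.1 + c * (lorentzVec z).2.2
      = (a * (z.re ^ 2 + z.im ^ 2) + b * z.re + c) / z.im := by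
      simp only [lorentzVec]; field_simp
    rw [this]
    exact ⟨fun h => div_nonneg h hz.le, fun h => by simpa using (le_div_iff₀ hz).1 h⟩
  intro x hx y hy z hz
  rcases eq_or_ne x y with rfl | hxy
  · have : dist x z = 0 := by
      have : dist x z + dist z x = dist x x := hz
      rw [dist_self, dist_comm z x] at this; linarith
    rw [← dist_eq_zero.1 this]; exact hx
  simp only [mem_ofPred_eq, key] at hx hy ⊢
  have hz' : dist x z + dist z y = dist x y := hz
  rw [lorentzVec_eq_geodVec hxy hz']
  have hS := sinh_dist_pos hxy
  have h1 : 0 ≤ Real.sinh (dist x y - dist x z) / Real.sinh (dist x y) :=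
    div_nonneg (Real.sinh_nonneg_iff.2 (by linarith [dist_nonneg (x := z) (y := y)])) hS.le
  have h2 : 0 ≤ Real.sinh (dist x z) / Real.sinh (dist x y) :=
    div_nonneg (Real.sinh_nonneg_iff.2 dist_nonneg) hS.le
  simp only [geodVec, Prod.fst_add, Prod.snd_add, Prod.smul_fst, Prod.smul_snd, smul_eq_mul]
  nlinarith [mul_nonneg h1 hx, mul_nonneg h2 hy]

lemma GeodConvex.inter {X : Type*} [MetricSpace X] {C D : Set X} (hC : GeodConvex C)
    (hD : GeodConvex D) : GeodConvex (C ∩ D) :=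
  fun x hx y hy => subset_inter (hC x hx.1 y hy.1) (hD x hx.2 y hy.2)

lemma geodHull_subset {X : Type*} [MetricSpace X] {S C : Set X} (hS : S ⊆ C) (hC : GeodConvex C) :
    geodHull S ⊆ C := sInter_subset_of_mem ⟨hS, hC⟩

lemma subset_geodHull {X : Type*} [MetricSpace X] (S : Set X) : S ⊆ geodHull S :=
  subset_sInter fun _ hC => hC.1

lemma geodConvex_geodHull {X : Type*} [MetricSpace X] (S : Set X) : GeodConvex (geodHull S) :=
  fun x hx y hy => subset_sInter fun C hC => hC.2 x (hx C hC) y (hy C hC)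

/-! ### The triangle inequality for upper angles -/

/-- In the Euclidean triangle with sides `s`, `t` and the angle `α + β` between them, the ray
that splits the angle into `α` and `β` has length `r` and splits the third side into pieces of
lengths `u` and `v`. -/
lemma exists_split_triangle {s t α β : ℝ} (hs : 0 < s) (ht : 0 < t) (hα : 0 < α) (hβ : 0 < β)
    (h : α + β < π) :
    ∃ r u v : ℝ, 0 < r ∧ r ≤ max s t ∧ 0 ≤ u ∧ 0 ≤ v ∧
      u ^ 2 = s ^ 2 + r ^ 2 - 2 * s * r * Real.cos α ∧
      v ^ 2 = r ^ 2 + t ^ 2 - 2 * r * t * Real.cos β ∧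
      (u + v) ^ 2 = s ^ 2 + t ^ 2 - 2 * s * t * Real.cos (α + β) := by
  have ha : 0 < Real.sin α := Real.sin_pos_of_pos_of_lt_pi hα (by linarith)
  have hb : 0 < Real.sin β := Real.sin_pos_of_pos_of_lt_pi hβ (by linarith)
  have hS : 0 < Real.sin (α + β) := Real.sin_pos_of_pos_of_lt_pi (by linarith) h
  have h1 := Real.sin_sq_add_cos_sq α
  have h2 := Real.sin_sq_add_cos_sq β
  have hc := Real.cos_le_one α
  have he := Real.cos_le_one β
  have hL0 : 0 ≤ s ^ 2 + t ^ 2 - 2 * s * t * Real.cos (α + β) := by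
    nlinarith [sq_nonneg (s - t), Real.cos_le_one (α + β), mul_pos hs ht]
  have hL := Real.sq_sqrt hL0
  have hLn := Real.sqrt_nonneg (s ^ 2 + t ^ 2 - 2 * s * t * Real.cos (α + β))
  set L := √(s ^ 2 + t ^ 2 - 2 * s * t * Real.cos (α + β))
  rw [Real.sin_add] at hS
  rw [Real.cos_add] at hL ⊢
  generalize Real.sin α = a at *
  generalize Real.sin β = b at *
  generalize Real.cos α = c at *
  generalize Real.cos β = e at *
  have hD : 0 < s * a + t * b := by positivity
  -- comparing areas, `s t sin (α + β) = s r sin α + r t sin β`; the third side is divided in the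
  -- ratio of the areas of the two parts
  refine ⟨s * t * (a * e + c * b) / (s * a + t * b), L * (s * a) / (s * a + t * b),
    L * (t * b) / (s * a + t * b), by positivity, ?_, by positivity, by positivity, ?_, ?_, ?_⟩
  · rw [div_le_iff₀ hD]
    have m1 := le_max_left s t
    have m2 := le_max_right s t
    have k1 : a * e + c * b ≤ a + b := by nlinarith
    calc s * t * (a * e + c * b) ≤ s * t * (a + b) := by gcongr
      _ = t * (s * a) + s * (t * b) := by ring
      _ ≤ max s t * (s * a) + max s t * (t * b) := by gcongr
      _ = _ := by ring
  · rw [div_pow, mul_pow, hL]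
    field_simp
    have e1 : c ^ 2 = 1 - a ^ 2 := by linarith
    have e2 : e ^ 2 = 1 - b ^ 2 := by linarith
    ring_nf
    simp only [e1, e2]
    ring
  · rw [div_pow, mul_pow, hL]
    field_simp
    have e1 : c ^ 2 = 1 - a ^ 2 := by linarith
    have e2 : e ^ 2 = 1 - b ^ 2 := by linarith
    ring_nf
    simp only [e1, e2]
    ring
  · rw [← add_div, ← mul_add, mul_div_cancel_right₀ _ hD.ne', hL]

/-- If the comparison angle is less than `α`, the third side is shorter than in the Euclidean
triangle with the angle `α`. -/
lemma lt_of_comparisonAngle_lt {X : Type*} [MetricSpace X] {p q r : X} {α u : ℝ}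
    (hq : 0 < dist p q) (hr : 0 < dist p r) (hα : 0 ≤ α) (hα' : α ≤ π) (hu : 0 ≤ u)
    (h : comparisonAngle p q r < α)
    (huv : u ^ 2 = dist p q ^ 2 + dist p r ^ 2 - 2 * dist p q * dist p r * Real.cos α) :
    dist q r < u := by
  have : Real.cos α < (dist p q ^ 2 + dist p r ^ 2 - dist q r ^ 2) / (2 * dist p q * dist p r) := by
    by_contra! hle
    have := Real.arccos_le_arccos hle
    rw [Real.arccos_cos hα hα'] at this
    exact absurd h (not_lt.2 this)
  rw [lt_div_iff₀ (by positivity)] at this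
  exact lt_of_pow_lt_pow_left₀ 2 hu (by linarith)

/-- If the comparison angle is greater than `α`, the third side is longer than in the Euclidean
triangle with the angle `α`. -/
lemma lt_of_lt_comparisonAngle {X : Type*} [MetricSpace X] {p q r : X} {α u : ℝ}
    (hq : 0 < dist p q) (hr : 0 < dist p r) (hα : 0 ≤ α) (hα' : α ≤ π)
    (h : α < comparisonAngle p q r)
    (huv : u ^ 2 = dist p q ^ 2 + dist p r ^ 2 - 2 * dist p q * dist p r * Real.cos α) :
    u < dist q r := by
  have : (dist p q ^ 2 + dist p r ^ 2 - dist q r ^ 2) / (2 * dist p q * dist p r) < Real.cos α := by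
    by_contra! hle
    have := Real.arccos_le_arccos hle
    rw [Real.arccos_cos hα hα'] at this
    exact absurd h (not_lt.2 this)
  rw [div_lt_iff₀ (by positivity)] at this
  exact lt_of_pow_lt_pow_left₀ 2 dist_nonneg (by linarith)

/-- Upper angles satisfy the triangle inequality: otherwise there would be a Euclidean triangle
whose third side, cut by the ray of length `r` in the direction of the middle geodesic, would
contradict the triangle inequality in `X`. -/
theorem upperAngle_triangle {X : Type*} [MetricSpace X] {c₁ c₂ c₃ : ℝ → X}
    (h12 : c₁ 0 = c₂ 0) (h23 : c₂ 0 = c₃ 0)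
    (h1 : ∀ᶠ s in 𝓝[>] 0, dist (c₁ 0) (c₁ s) = s) (h2 : ∀ᶠ s in 𝓝[>] 0, dist (c₂ 0) (c₂ s) = s)
    (h3 : ∀ᶠ s in 𝓝[>] 0, dist (c₃ 0) (c₃ s) = s) :
    upperAngle c₁ c₃ ≤ upperAngle c₁ c₂ + upperAngle c₂ c₃ := by
  by_contra! hlt
  -- `γ < π` is an angle between the two sides of the inequality, split as `(A + η) + (B + η)`
  obtain ⟨γ, hγ, hγ'⟩ := exists_between hlt
  set A := upperAngle c₁ c₂ with hA
  set B := upperAngle c₂ c₃ with hB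
  have hA0 : 0 ≤ A := upperAngle_nonneg _ _
  have hB0 : 0 ≤ B := upperAngle_nonneg _ _
  obtain ⟨η, hη⟩ : ∃ η, η = (γ - A - B) / 2 := ⟨_, rfl⟩
  have hη0 : 0 < η := by rw [hη]; linarith
  have hγπ : γ < π := hγ'.trans_le (upperAngle_le_pi _ _)
  have e12 : ∀ᶠ t : ℝ × ℝ in 𝓝[>] 0 ×ˢ 𝓝[>] 0,
      comparisonAngle (c₁ 0) (c₁ t.1) (c₂ t.2) < A + η :=
    eventually_lt_of_limsup_lt (by rw [← upperAngle, ← hA]; linarith)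
      (isBoundedUnder_comparisonAngle _ _ _ _)
  have e23 : ∀ᶠ t : ℝ × ℝ in 𝓝[>] 0 ×ˢ 𝓝[>] 0,
      comparisonAngle (c₂ 0) (c₂ t.1) (c₃ t.2) < B + η :=
    eventually_lt_of_limsup_lt (by rw [← upperAngle, ← hB]; linarith)
      (isBoundedUnder_comparisonAngle _ _ _ _)
  have f13 : ∃ᶠ t : ℝ × ℝ in 𝓝[>] 0 ×ˢ 𝓝[>] 0,
      γ < comparisonAngle (c₁ 0) (c₁ t.1) (c₃ t.2) :=
    frequently_lt_of_lt_limsup (isCoboundedUnder_comparisonAngle _ _ _ _) hγ'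
  have hall := (((h1.and h2).and h3).prod_mk ((h1.and h2).and h3)).and (e12.and e23)
  rw [(nhdsGT_basis (0 : ℝ)).prod_self.eventually_iff] at hall
  obtain ⟨ε, hε, hall⟩ := hall
  have hmem : ∀ᶠ t : ℝ × ℝ in 𝓝[>] 0 ×ˢ 𝓝[>] 0, t ∈ Ioo 0 ε ×ˢ Ioo 0 ε :=
    (nhdsGT_basis (0 : ℝ)).prod_self.mem_of_mem hε
  obtain ⟨⟨s, t⟩, hst, ⟨hs, hs'⟩, ⟨ht, ht'⟩⟩ := (f13.and_eventually hmem).exists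
  simp only at hs hs' ht ht' hst
  obtain ⟨r, u, v, hr, hr', hu, hv, hu2, hv2, huv⟩ :=
    exists_split_triangle hs ht (α := A + η) (β := B + η) (by linarith) (by linarith)
      (by rw [hη]; linarith)
  have hrε : r < ε := hr'.trans_lt (max_lt hs' ht')
  obtain ⟨⟨⟨⟨d1, -⟩, -⟩, ⟨-, d2⟩, -⟩, a12, -⟩ := hall (x := (s, r)) ⟨⟨hs, hs'⟩, hr, hrε⟩
  obtain ⟨⟨-, -, d3⟩, -, a23⟩ := hall (x := (r, t)) ⟨⟨hr, hrε⟩, ht, ht'⟩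
  simp only at d1 d2 d3 a12 a23
  have d2' : dist (c₁ 0) (c₂ r) = r := by rw [h12, d2]
  have d3' : dist (c₂ 0) (c₃ t) = t := by rw [h23, d3]
  have d3'' : dist (c₁ 0) (c₃ t) = t := by rw [h12, h23, d3]
  have k1 : dist (c₁ s) (c₂ r) < u := by
    refine lt_of_comparisonAngle_lt (by rwa [d1]) (by rwa [d2']) (by linarith)
      (by rw [hη]; linarith) hu a12 ?_
    rw [d1, d2', hu2]
  have k2 : dist (c₂ r) (c₃ t) < v := by
    refine lt_of_comparisonAngle_lt (by rwa [d2]) (by rwa [d3']) (by linarith)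
      (by rw [hη]; linarith) hv a23 ?_
    rw [d2, d3', hv2]
  have k3 : u + v < dist (c₁ s) (c₃ t) := by
    refine lt_of_lt_comparisonAngle (by rwa [d1]) (by rwa [d3'']) (by linarith) hγπ.le hst ?_
    rw [d1, d3'', huv]
    congr 3
    rw [hη]; ring
  linarith [dist_triangle (c₁ s) (c₂ r) (c₃ t)]

lemma upperAngle_comm {X : Type*} [MetricSpace X] {c c' : ℝ → X} (h : c 0 = c' 0) :
    upperAngle c c' = upperAngle c' c := by
  unfold upperAngle
  conv_lhs => rw [Filter.prod_comm, limsup, map_map]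
  apply congrArg limsSup
  congr 1
  funext t
  simp only [Function.comp, comparisonAngle, Prod.fst_swap, Prod.snd_swap]
  rw [h, dist_comm (c t.2), add_comm (dist _ _ ^ 2), mul_right_comm]

/-- The upper angle depends only on the distances near the initial point. -/
lemma upperAngle_congr {X Y : Type*} [MetricSpace X] [MetricSpace Y] {c c' : ℝ → X}
    {b b' : ℝ → Y} (h1 : ∀ᶠ s in 𝓝[>] 0, dist (c 0) (c s) = dist (b 0) (b s))
    (h2 : ∀ᶠ s in 𝓝[>] 0, dist (c 0) (c' s) = dist (b 0) (b' s))
    (h3 : ∀ᶠ t : ℝ × ℝ in 𝓝[>] 0 ×ˢ 𝓝[>] 0, dist (c t.1) (c' t.2) = dist (b t.1) (b' t.2)) :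
    upperAngle c c' = upperAngle b b' := by
  unfold upperAngle
  apply limsup_congr
  filter_upwards [h1.prod_mk h2, h3] with t ht ht3
  unfold comparisonAngle
  rw [ht.1, ht.2, ht3]

/-! ### The area of a hyperbolic triangle -/

/-- The sum of the angles of the triangle `x`, `y`, `z`. -/
def hypAngleSum (x y z : ℍ) : ℝ := hypAngle x y z + hypAngle y z x + hypAngle z x y

lemma hypAngleSum_rotate (x y z : ℍ) : hypAngleSum y z x = hypAngleSum x y z := by
  unfold hypAngleSum; ring

lemma hypAngleSum_swap (x y z : ℍ) : hypAngleSum y x z = hypAngleSum x y z := by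
  unfold hypAngleSum
  rw [hypAngle_comm y x z, hypAngle_comm x z y, hypAngle_comm z y x]; ring

/-- The area of the triangle `x`, `y`, `z` is at most `π` minus the sum of its angles. -/
def AreaBound (x y z : ℍ) : Prop :=
  hypAngleSum x y z ≤ π ∧
    volume (geodHull {x, y, z}) ≤ ENNReal.ofReal (π - hypAngleSum x y z)

lemma AreaBound.rotate {x y z : ℍ} (h : AreaBound x y z) : AreaBound y z x := by
  unfold AreaBound at *
  have : ({y, z, x} : Set ℍ) = {x, y, z} := by
    rw [insert_comm x y, pair_comm x z]
  rwa [this, hypAngleSum_rotate]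

lemma AreaBound.swap {x y z : ℍ} (h : AreaBound x y z) : AreaBound y x z := by
  unfold AreaBound at *
  rwa [insert_comm, hypAngleSum_swap]

lemma AreaBound.of_smul {x y z : ℍ} (g : Matrix.SpecialLinearGroup (Fin 2) ℝ)
    (h : AreaBound (g • x) (g • y) (g • z)) : AreaBound x y z := by
  have hv : volume (geodHull {x, y, z}) ≤ volume (geodHull {g • x, g • y, g • z}) := by
    have hsub : geodHull {x, y, z} ⊆ (g • ·) ⁻¹' geodHull {g • x, g • y, g • z} := by
      apply geodHull_subset
      · have := subset_geodHull {g • x, g • y, g • z}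
        rintro w (rfl | rfl | rfl) <;> exact this (by simp)
      · intro a ha b hb c hc
        refine geodConvex_geodHull _ _ ha _ hb ?_
        have hc' : dist a c + dist c b = dist a b := hc
        show dist (g • a) (g • c) + dist (g • c) (g • b) = dist (g • a) (g • b)
        rwa [dist_smul, dist_smul, dist_smul]
    refine (measure_mono hsub).trans_eq ?_
    exact measure_preimage_smul (μ := (volume : Measure ℍ))
      (g : Matrix.GeneralLinearGroup (Fin 2) ℝ) _
  unfold AreaBound at *
  simp only [hypAngleSum, hypAngle, hypCos, dist_smul] at h ⊢
  exact ⟨h.1, hv.trans h.2⟩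

/-- Degenerate triangles: the angles are `0`, `π` and `0`. -/
lemma hypAngleSum_of_dist_add {x y z : ℍ} (hxy : x ≠ y) (hyz : y ≠ z) (hxz : x ≠ z)
    (h : dist x y + dist y z = dist x z) : hypAngleSum x y z = π := by
  have h1 := (sinh_dist_pos hxy).ne'
  have h2 := (sinh_dist_pos hyz).ne'
  have h3 := (sinh_dist_pos hxz).ne'
  have e1 : hypCos x y z = 1 := by
    unfold hypCos
    rw [div_eq_one_iff_eq (mul_ne_zero h1 h3), show dist y z = dist x z - dist x y by linarith,
      Real.cosh_sub]
    ring
  have e2 : hypCos y z x = -1 := by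
    unfold hypCos
    rw [dist_comm y x, dist_comm z x, div_eq_iff (mul_ne_zero h2 h1), ← h, Real.cosh_add]
    ring
  have e3 : hypCos z x y = 1 := by
    unfold hypCos
    rw [dist_comm z x, dist_comm z y, div_eq_one_iff_eq (mul_ne_zero h3 h2),
      show dist x y = dist x z - dist y z by linarith, Real.cosh_sub]
    ring
  unfold hypAngleSum hypAngle
  rw [e1, e2, e3, Real.arccos_one, Real.arccos_neg_one]
  ring

/-- The imaginary axis is a geodesic. -/
lemma dist_add_dist_of_re_eq_zero {x y z : ℍ} (hx : x.re = 0) (hy : y.re = 0) (hz : z.re = 0)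
    (h1 : x.im ≤ y.im) (h2 : y.im ≤ z.im) : dist x y + dist y z = dist x z := by
  rw [UpperHalfPlane.dist_of_re_eq (hx.trans hy.symm), UpperHalfPlane.dist_of_re_eq
    (hy.trans hz.symm), UpperHalfPlane.dist_of_re_eq (hx.trans hz.symm)]
  have l1 := Real.log_le_log x.im_pos h1
  have l2 := Real.log_le_log y.im_pos h2
  rw [Real.dist_eq, Real.dist_eq, Real.dist_eq, abs_of_nonpos (by linarith),
    abs_of_nonpos (by linarith), abs_of_nonpos (by linarith)]
  ring

lemma volume_imaginary_axis : volume {z : ℍ | z.re = 0} = 0 := by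
  rw [UpperHalfPlane.volume_eq_lintegral]
  apply setLIntegral_measure_zero
  refine measure_mono_null (t := {z : ℂ | z.re = 0}) ?_ ?_
  · rintro _ ⟨z, hz, rfl⟩; exact hz
  · have : {z : ℂ | z.re = 0} = Complex.measurableEquivRealProd ⁻¹' ({0} ×ˢ univ) := by
      ext z; simp
    rw [this, Complex.volume_preserving_equiv_real_prod.measure_preimage_equiv,
      Measure.volume_eq_prod, Measure.prod_prod]
    simp

lemma volume_geodHull_imaginary_axis {x y z : ℍ} (hx : x.re = 0) (hy : y.re = 0)
    (hz : z.re = 0) : volume (geodHull {x, y, z}) = 0 := by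
  refine measure_mono_null ?_ volume_imaginary_axis
  have h := (geodConvex_halfPlane 0 1 0).inter (geodConvex_halfPlane 0 (-1) 0)
  refine (geodHull_subset ?_ h).trans ?_
  · rintro w (rfl | rfl | rfl) <;> simp [*]
  · rintro w ⟨h1, h2⟩
    simp only [mem_ofPred_eq] at h1 h2 ⊢
    linarith

lemma areaBound_imaginary_axis {x y z : ℍ} (hxy : x ≠ y) (hyz : y ≠ z) (hxz : x ≠ z)
    (hx : x.re = 0) (hy : y.re = 0) (hz : z.re = 0) : AreaBound x y z := by
  have key : ∀ {x y z : ℍ}, x ≠ y → y ≠ z → x ≠ z → x.re = 0 → y.re = 0 → z.re = 0 →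
      x.im ≤ y.im → y.im ≤ z.im → AreaBound x y z := by
    intro x y z hxy hyz hxz hx hy hz h1 h2
    have := hypAngleSum_of_dist_add hxy hyz hxz (dist_add_dist_of_re_eq_zero hx hy hz h1 h2)
    refine ⟨this.le, ?_⟩
    rw [volume_geodHull_imaginary_axis hx hy hz]
    exact zero_le
  rcases le_total x.im y.im with h1 | h1 <;> rcases le_total y.im z.im with h2 | h2 <;>
    rcases le_total x.im z.im with h3 | h3
  · exact key hxy hyz hxz hx hy hz h1 h2
  · exact key hxy hyz hxz hx hy hz h1 h2
  · exact (key hxz hyz.symm hxy hx hz hy h3 h2).swap.rotate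
  · exact (key hxz.symm hxy hyz.symm hz hx hy h3 h1).rotate
  · exact (key hxy.symm hxz hyz hy hx hz h1 h3).swap
  · exact (key hyz hxz.symm hxy.symm hy hz hx h2 h3).rotate.rotate
  · exact (key hyz.symm hxy.symm hxz.symm hz hy hx h2 h1).rotate.swap
  · exact (key hyz.symm hxy.symm hxz.symm hz hy hx h2 h1).rotate.swap

/-- A non-negative derivative has the lower integral given by the fundamental theorem of
calculus. -/
lemma lintegral_Icc_deriv {F f : ℝ → ℝ} {a b : ℝ} (hab : a ≤ b)
    (hF : ∀ x ∈ Icc a b, HasDerivAt F (f x) x) (hc : ContinuousOn f (Icc a b))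
    (h0 : ∀ x ∈ Icc a b, 0 ≤ f x) :
    F a ≤ F b ∧ ∫⁻ x in Icc a b, ENNReal.ofReal (f x) = ENNReal.ofReal (F b - F a) := by
  have hint : IntegrableOn f (Icc a b) := hc.integrableOn_Icc
  have hi : ∫ x in a..b, f x = F b - F a :=
    intervalIntegral.integral_eq_sub_of_hasDerivAt (by rwa [uIcc_of_le hab])
      ((intervalIntegrable_iff_integrableOn_Icc_of_le hab).2 hint)
  constructor
  · have : 0 ≤ ∫ x in a..b, f x := intervalIntegral.integral_nonneg hab h0
    linarith
  · rw [← hi, intervalIntegral.integral_of_le hab, ← integral_Icc_eq_integral_Ioc,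
      ofReal_integral_eq_lintegral_ofReal hint]
    exact (ae_restrict_iff' measurableSet_Icc).2 (Eventually.of_forall h0)

/-- The hyperbolic area of the region between two graphs. -/
lemma volume_le_of_between {S : Set ℍ} {a b : ℝ} {g h : ℝ → ℝ} (hg : ContinuousOn g (Icc a b))
    (hh : ContinuousOn h (Icc a b)) (hg0 : ∀ x ∈ Icc a b, 0 < g x) (hgh : ∀ x ∈ Icc a b, g x ≤ h x)
    (hS : ∀ z ∈ S, z.re ∈ Icc a b ∧ g z.re ≤ z.im ∧ z.im ≤ h z.re) :
    volume S ≤ ∫⁻ x in Icc a b, ENNReal.ofReal (1 / g x - 1 / h x) := by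
  set T : Set (ℝ × ℝ) := {p | p.1 ∈ Icc a b ∧ g p.1 ≤ p.2 ∧ p.2 ≤ h p.1} with hT
  have hTm : MeasurableSet T := by
    have h1 : IsClosed ((Icc a b) ×ˢ (univ : Set ℝ)) := isClosed_Icc.prod isClosed_univ
    have e : T = {p ∈ (Icc a b) ×ˢ (univ : Set ℝ) | g p.1 ≤ p.2} ∩
        {p ∈ (Icc a b) ×ˢ (univ : Set ℝ) | p.2 ≤ h p.1} := by
      ext p; simp [hT]; tauto
    rw [e]
    have m : MapsTo (Prod.fst : ℝ × ℝ → ℝ) ((Icc a b) ×ˢ (univ : Set ℝ)) (Icc a b) :=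
      fun p hp => hp.1
    exact ((h1.isClosed_le (hg.comp continuousOn_fst m) continuousOn_snd).inter
      (h1.isClosed_le continuousOn_snd (hh.comp continuousOn_fst m))).measurableSet
  rw [UpperHalfPlane.volume_eq_lintegral]
  have hsub : UpperHalfPlane.coe '' S ⊆ Complex.measurableEquivRealProd ⁻¹' T := by
    rintro _ ⟨z, hz, rfl⟩
    exact hS z hz
  refine (lintegral_mono_set hsub).trans ?_
  refine (Complex.volume_preserving_equiv_real_prod.setLIntegral_comp_preimage_emb
    Complex.measurableEquivRealProd.measurableEmbedding
    (fun p : ℝ × ℝ => (((1 / ‖p.2‖₊) ^ 2 : NNReal) : ENNReal)) T).trans_le ?_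
  rw [← lintegral_indicator hTm, Measure.volume_eq_prod]
  have hm : Measurable (fun p : ℝ × ℝ => (((1 / ‖p.2‖₊) ^ 2 : NNReal) : ENNReal)) := by fun_prop
  rw [lintegral_prod _ (hm.indicator hTm).aemeasurable, ← lintegral_indicator measurableSet_Icc]
  refine lintegral_mono fun x => ?_
  by_cases hx : x ∈ Icc a b
  · rw [indicator_of_mem hx]
    have e : ∀ y, T.indicator (fun p : ℝ × ℝ => (((1 / ‖p.2‖₊) ^ 2 : NNReal) : ENNReal)) (x, y)
        = (Icc (g x) (h x)).indicator (fun y => ENNReal.ofReal (1 / y ^ 2)) y := by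
      intro y
      by_cases hy : y ∈ Icc (g x) (h x)
      · rw [indicator_of_mem hy, indicator_of_mem (show (x, y) ∈ T from ⟨hx, hy⟩)]
        rw [ENNReal.ofReal, Real.toNNReal_of_nonneg (by positivity)]
        congr 1
        ext
        simp
      · rw [indicator_of_notMem hy, indicator_of_notMem (fun hxy : (x, y) ∈ T => hy hxy.2)]
    simp_rw [e]
    rw [lintegral_indicator measurableSet_Icc]
    have hpos : ∀ y ∈ Icc (g x) (h x), y ≠ 0 := fun y hy => ((hg0 x hx).trans_le hy.1).ne'
    refine ((lintegral_Icc_deriv (F := fun y => -(1 / y)) (hgh x hx) ?_ ?_ ?_).2).trans_le ?_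
    · intro y hy
      simp only [one_div]
      convert! (hasDerivAt_inv (hpos y hy)).neg using 1
      simp
    · exact continuousOn_const.div (continuousOn_id.pow 2) fun y hy => pow_ne_zero 2 (hpos y hy)
    · intro y _; positivity
    · apply ENNReal.ofReal_le_ofReal; linarith
  · rw [indicator_of_notMem hx]
    have e : ∀ y, T.indicator (fun p : ℝ × ℝ => (((1 / ‖p.2‖₊) ^ 2 : NNReal) : ENNReal)) (x, y)
        = 0 := fun y => indicator_of_notMem (fun hxy : (x, y) ∈ T => hx hxy.1) _
    rw [lintegral_congr e, lintegral_zero]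

/-- The Euclidean angle along a circle: the derivative of `-arccos ((x - c) / R)`. -/
lemma hasDerivAt_neg_arccos {c R x : ℝ} (hR : 0 < R) (h : 0 < R ^ 2 - (x - c) ^ 2) :
    HasDerivAt (fun x => -Real.arccos ((x - c) / R)) (1 / √(R ^ 2 - (x - c) ^ 2)) x := by
  have habs : |(x - c) / R| < 1 := by
    rw [abs_div, abs_of_pos hR, div_lt_one hR]
    exact abs_lt_of_sq_lt_sq (by linarith) hR.le
  rw [abs_lt] at habs
  have h1 : HasDerivAt (fun x => (x - c) / R) (1 / R) x :=
    ((hasDerivAt_id x).sub_const c).div_const R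
  have h2 := ((Real.hasDerivAt_arccos habs.1.ne' habs.2.ne).comp x h1).neg
  convert! h2 using 1
  have e : 1 - ((x - c) / R) ^ 2 = (R ^ 2 - (x - c) ^ 2) / R ^ 2 := by field_simp
  rw [e, Real.sqrt_div' _ (by positivity), Real.sqrt_sq hR.le]
  have := Real.sqrt_pos.2 h
  field_simp


lemma div_sqrt_le_div_sqrt {u v y : ℝ} (hy : 0 < y) (h : u ≤ v) :
    u / √(u ^ 2 + y ^ 2) ≤ v / √(v ^ 2 + y ^ 2) := by
  have key : ∀ u : ℝ, u / √(u ^ 2 + y ^ 2) = Real.sin (Real.arctan (u / y)) := by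
    intro u
    have e : 1 + (u / y) ^ 2 = (u ^ 2 + y ^ 2) / y ^ 2 := by field_simp; ring
    rw [Real.sin_arctan, e, Real.sqrt_div' _ (by positivity), Real.sqrt_sq hy.le]
    have : 0 < √(u ^ 2 + y ^ 2) := Real.sqrt_pos.2 (by positivity)
    field_simp
  rw [key, key]
  have h1 := Real.arctan_strictMono.monotone (div_le_div_of_nonneg_right h hy.le)
  exact Real.sin_le_sin_of_le_of_le_pi_div_two (Real.neg_pi_div_two_lt_arctan _).le
    (Real.arctan_lt_pi_div_two _).le h1

lemma sinh_dist_eq {x y : ℍ} {v : ℝ} (hv : 0 ≤ v) (h : Real.cosh (dist x y) ^ 2 = 1 + v ^ 2) :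
    Real.sinh (dist x y) = v := by
  have h1 : Real.sinh (dist x y) ^ 2 = v ^ 2 := by
    have := Real.cosh_sq (dist x y); linarith
  have h2 : 0 ≤ Real.sinh (dist x y) := Real.sinh_nonneg_iff.2 dist_nonneg
  exact (sq_eq_sq₀ h2 hv).1 h1

/-- The cosines of the angles of a triangle with a vertical side, whose other sides lie on circles
with centres `c`, `d` on the real axis and radii `R`, `S`. -/
lemma hypCos_vertical {A B C : ℍ} {c d R S : ℝ} (hA : A.re = 0) (hB : B.re = 0)
    (hC : 0 < C.re) (hAB : A.im < B.im)
    (hcx : 2 * c * C.re = C.re ^ 2 + C.im ^ 2 - A.im ^ 2)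
    (hdx : 2 * d * C.re = C.re ^ 2 + C.im ^ 2 - B.im ^ 2)
    (hR0 : 0 < R) (hS0 : 0 < S) (hRR : R ^ 2 = c ^ 2 + A.im ^ 2) (hSS : S ^ 2 = d ^ 2 + B.im ^ 2) :
    hypCos A B C = c / R ∧ hypCos B C A = -d / S ∧
      hypCos C A B = (C.re - c) / R * ((C.re - d) / S) + C.im / R * (C.im / S) := by
  have hp := A.im_pos
  have hq := B.im_pos
  have hy := C.im_pos
  have cAB := UpperHalfPlane.cosh_dist' A B
  have cAC := UpperHalfPlane.cosh_dist' A C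
  have cBC := UpperHalfPlane.cosh_dist' B C
  rw [hA, hB] at cAB
  rw [hA] at cAC
  rw [hB] at cBC
  unfold hypCos
  rw [dist_comm C A, dist_comm C B, dist_comm B A]
  have hpq : A.im ^ 2 < B.im ^ 2 := pow_lt_pow_left₀ hAB hp.le two_ne_zero
  have sAB : Real.sinh (dist A B) = (B.im ^ 2 - A.im ^ 2) / (2 * A.im * B.im) := by
    apply sinh_dist_eq
    · apply div_nonneg <;> [linarith; positivity]
    · rw [cAB]; field_simp; ring
  have sAC : Real.sinh (dist A C) = C.re * R / (A.im * C.im) := by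
    apply sinh_dist_eq (by positivity)
    rw [cAC, div_pow (C.re * R), mul_pow, hRR]
    field_simp
    linear_combination (-(2 * c * C.re) - (C.re ^ 2 + C.im ^ 2 - A.im ^ 2)) * hcx
  have sBC : Real.sinh (dist B C) = C.re * S / (B.im * C.im) := by
    apply sinh_dist_eq (by positivity)
    rw [cBC, div_pow (C.re * S), mul_pow, hSS]
    field_simp
    linear_combination (-(2 * d * C.re) - (C.re ^ 2 + C.im ^ 2 - B.im ^ 2)) * hdx
  rw [cAB, cAC, cBC, sAB, sAC, sBC]
  generalize A.im = p at *
  generalize B.im = q at *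
  generalize C.im = y at *
  generalize C.re = x at *
  have hqp : q ^ 2 - p ^ 2 ≠ 0 := by linarith
  refine ⟨?_, ?_, ?_⟩
  · field_simp
    linear_combination -(q ^ 2 - p ^ 2) * hcx
  · field_simp
    linear_combination (q ^ 2 - p ^ 2) * hdx
  · field_simp
    linear_combination (x ^ 2 - y ^ 2 + p ^ 2) * hdx + (2 * x ^ 2 - 2 * d * x) * hcx

/-- A triangle with a vertical side lies between two circular arcs, and its area is an integral
of `1 / y` along them, which gives differences of Euclidean angles. -/
lemma areaBound_vertical {A B C : ℍ} (hA : A.re = 0) (hB : B.re = 0) (hC : 0 < C.re)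
    (hAB : A.im < B.im) : AreaBound A B C := by
  -- centres and radii of the circles through `A`, `C` and through `B`, `C`
  obtain ⟨c, hcx⟩ : ∃ c, 2 * c * C.re = C.re ^ 2 + C.im ^ 2 - A.im ^ 2 :=
    ⟨(C.re ^ 2 + C.im ^ 2 - A.im ^ 2) / (2 * C.re), by field_simp⟩
  obtain ⟨d, hdx⟩ : ∃ d, 2 * d * C.re = C.re ^ 2 + C.im ^ 2 - B.im ^ 2 :=
    ⟨(C.re ^ 2 + C.im ^ 2 - B.im ^ 2) / (2 * C.re), by field_simp⟩
  obtain ⟨R, hR0, hRR⟩ : ∃ R, 0 < R ∧ R ^ 2 = c ^ 2 + A.im ^ 2 := by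
    have := A.im_pos
    exact ⟨√(c ^ 2 + A.im ^ 2), Real.sqrt_pos.2 (by positivity), Real.sq_sqrt (by positivity)⟩
  obtain ⟨S, hS0, hSS⟩ : ∃ S, 0 < S ∧ S ^ 2 = d ^ 2 + B.im ^ 2 := by
    have := B.im_pos
    exact ⟨√(d ^ 2 + B.im ^ 2), Real.sqrt_pos.2 (by positivity), Real.sq_sqrt (by positivity)⟩
  -- `aA`, `aB`, `aC` are the cosines of the angles at `A`, `B`, `C`
  obtain ⟨aA, aB, aC⟩ := hypCos_vertical hA hB hC hAB hcx hdx hR0 hS0 hRR hSS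
  have hp := A.im_pos
  have hq := B.im_pos
  have hy := C.im_pos
  obtain ⟨p, hpe⟩ : ∃ p, A.im = p := ⟨_, rfl⟩
  obtain ⟨q, hqe⟩ : ∃ q, B.im = q := ⟨_, rfl⟩
  obtain ⟨x, hxe⟩ : ∃ x, C.re = x := ⟨_, rfl⟩
  obtain ⟨y, hye⟩ : ∃ y, C.im = y := ⟨_, rfl⟩
  rw [hpe] at hp hAB hcx hRR
  rw [hqe] at hq hdx hSS hAB
  rw [hye] at hy hcx hdx aC
  rw [hxe] at hC hcx hdx aC
  have hpq : p ^ 2 < q ^ 2 := pow_lt_pow_left₀ hAB hp.le two_ne_zero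
  have hR2 : R ^ 2 = (x - c) ^ 2 + y ^ 2 := by linarith
  have hS2 : S ^ 2 = (x - d) ^ 2 + y ^ 2 := by linarith
  have hdc : d ≤ c := by
    have : 0 ≤ (c - d) * x := by linarith
    linarith [nonneg_of_mul_nonneg_left this hC]
  have hφ : (x - c) / R ≤ (x - d) / S := by
    have := div_sqrt_le_div_sqrt hy (show x - c ≤ x - d by linarith)
    rwa [← hR2, ← hS2, Real.sqrt_sq hR0.le, Real.sqrt_sq hS0.le] at this
  have bound : ∀ {u T : ℝ}, 0 < T → T ^ 2 = u ^ 2 + y ^ 2 →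
      -1 ≤ u / T ∧ u / T ≤ 1 ∧ √(1 - (u / T) ^ 2) = y / T := by
    intro u T hT h
    have h1 : |u / T| ≤ 1 := by
      rw [abs_div, abs_of_pos hT, div_le_one hT]
      exact abs_le_of_sq_le_sq (by linarith [sq_nonneg y]) hT.le
    refine ⟨(abs_le.1 h1).1, (abs_le.1 h1).2, ?_⟩
    rw [show 1 - (u / T) ^ 2 = (y / T) ^ 2 by field_simp; linarith]
    exact Real.sqrt_sq (by positivity)
  obtain ⟨bR, bR', bR2⟩ := bound hR0 hR2
  obtain ⟨bS, bS', bS2⟩ := bound hS0 hS2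
  have aC' : hypAngle C A B = Real.arccos ((x - c) / R) - Real.arccos ((x - d) / S) := by
    have h1 := Real.arccos_le_arccos hφ
    have h2 := Real.arccos_le_pi ((x - c) / R)
    have h3 := Real.arccos_nonneg ((x - d) / S)
    have h4 : hypCos C A B = Real.cos (Real.arccos ((x - c) / R) - Real.arccos ((x - d) / S)) := by
      rw [Real.cos_sub, Real.cos_arccos bR bR', Real.cos_arccos bS bS', Real.sin_arccos,
        Real.sin_arccos, bR2, bS2, aC]
    rw [hypAngle, h4, Real.arccos_cos (by linarith) (by linarith)]
  -- the antiderivative of the difference of the two densities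
  obtain ⟨G, hG⟩ : ∃ G : ℝ → ℝ,
    G = (fun t => -Real.arccos ((t - c) / R)) - fun t => -Real.arccos ((t - d) / S) := ⟨_, rfl⟩
  have hGsum : G x - G 0 = π - hypAngleSum A B C := by
    have e3 : Real.arccos ((0 - c) / R) = π - Real.arccos (c / R) := by
      rw [zero_sub, neg_div, Real.arccos_neg]
    rw [hypAngleSum, aC', hypAngle, hypAngle, aA, aB, hG]
    simp only [Pi.sub_apply, e3, zero_sub d]
    ring
  have fpos : ∀ t ∈ Icc 0 x, 0 < R ^ 2 - (t - c) ^ 2 := by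
    intro t ht
    have : (R ^ 2 - (t - c) ^ 2) * x = p ^ 2 * (x - t) + y ^ 2 * t + t * x * (x - t) := by
      rw [hRR]; linear_combination t * hcx
    have h2 : 0 < (R ^ 2 - (t - c) ^ 2) * x := by
      rw [this]
      rcases ht.1.eq_or_lt with h | h
      · rw [← h]; simp; positivity
      · have := sub_nonneg.2 ht.2
        positivity
    exact pos_of_mul_pos_left h2 hC.le
  have fle : ∀ t ∈ Icc 0 x, R ^ 2 - (t - c) ^ 2 ≤ S ^ 2 - (t - d) ^ 2 := by
    intro t ht
    have : (S ^ 2 - (t - d) ^ 2 - (R ^ 2 - (t - c) ^ 2)) * x = (q ^ 2 - p ^ 2) * (x - t) := by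
      rw [hRR, hSS]; linear_combination t * hdx - t * hcx
    have h2 : 0 ≤ (S ^ 2 - (t - d) ^ 2 - (R ^ 2 - (t - c) ^ 2)) * x := by
      rw [this]
      exact mul_nonneg (by linarith) (by linarith [ht.2])
    linarith [nonneg_of_mul_nonneg_left h2 hC]
  have spos : ∀ t ∈ Icc 0 x, 0 < √(R ^ 2 - (t - c) ^ 2) := fun t ht => Real.sqrt_pos.2 (fpos t ht)
  have sle : ∀ t ∈ Icc 0 x, √(R ^ 2 - (t - c) ^ 2) ≤ √(S ^ 2 - (t - d) ^ 2) :=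
    fun t ht => Real.sqrt_le_sqrt (fle t ht)
  have cR : ContinuousOn (fun t => √(R ^ 2 - (t - c) ^ 2)) (Icc 0 x) := by fun_prop
  have cS : ContinuousOn (fun t => √(S ^ 2 - (t - d) ^ 2)) (Icc 0 x) := by fun_prop
  have hder := lintegral_Icc_deriv (F := G)
    (f := fun t => 1 / √(R ^ 2 - (t - c) ^ 2) - 1 / √(S ^ 2 - (t - d) ^ 2)) hC.le
    (fun t ht => by
      rw [hG]
      exact (hasDerivAt_neg_arccos hR0 (fpos t ht)).sub
        (hasDerivAt_neg_arccos hS0 ((fpos t ht).trans_le (fle t ht))))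
    ((continuousOn_const.div cR fun t ht => (spos t ht).ne').sub
        (continuousOn_const.div cS fun t ht => ((spos t ht).trans_le (sle t ht)).ne'))
    (fun t ht => sub_nonneg.2 (one_div_le_one_div_of_le (spos t ht) (sle t ht)))
  refine ⟨by linarith [hder.1], ?_⟩
  rw [← hGsum, ← hder.2]
  apply volume_le_of_between cR cS spos sle
  -- the triangle is bounded by the vertical line and the two circles; right of `C` the lower
  -- circle is above the upper one, so no further half-plane is needed
  have hconv := ((geodConvex_halfPlane 0 1 0).inter
    (geodConvex_halfPlane 1 (-2 * c) (-p ^ 2))).inter (geodConvex_halfPlane (-1) (2 * d) (q ^ 2))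
  have hsub := geodHull_subset (S := {A, B, C}) ?_ hconv
  · intro z hz
    obtain ⟨⟨h1, h2⟩, h3⟩ := hsub hz
    simp only [mem_ofPred_eq] at h1 h2 h3
    have hz0 := z.im_pos
    refine ⟨⟨by linarith, ?_⟩, ?_, ?_⟩
    · have h4 : 0 ≤ (2 * d - 2 * c) * z.re + (q ^ 2 - p ^ 2) := by linarith
      have h5 : q ^ 2 - p ^ 2 = (2 * c - 2 * d) * x := by linarith
      have h6 : 0 < 2 * c - 2 * d := by
        have : 0 < (2 * c - 2 * d) * x := by linarith
        exact pos_of_mul_pos_left this hC.le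
      rw [h5] at h4
      have h7 : 0 ≤ (2 * c - 2 * d) * (x - z.re) := by linarith
      linarith [nonneg_of_mul_nonneg_right h7 h6]
    · apply Real.sqrt_le_iff.2 ⟨hz0.le, ?_⟩
      rw [hRR]; linarith
    · apply Real.le_sqrt_of_sq_le
      rw [hSS]; linarith
  · rintro w (rfl | rfl | rfl)
    · refine ⟨⟨?_, ?_⟩, ?_⟩ <;> simp only [mem_ofPred_eq, hA, hpe] <;> linarith
    · refine ⟨⟨?_, ?_⟩, ?_⟩ <;> simp only [mem_ofPred_eq, hB, hqe] <;> linarith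
    · refine ⟨⟨?_, ?_⟩, ?_⟩ <;> simp only [mem_ofPred_eq, hxe, hye] <;> linarith

/-- The Möbius transformation `z ↦ (a z + b) / (c z + d)`. -/
def moebius (a b c d : ℝ) (h : a * d - b * c = 1) : Matrix.SpecialLinearGroup (Fin 2) ℝ :=
  ⟨!![a, b; c, d], by rw [Matrix.det_fin_two_of, h]⟩

lemma moebius_smul_re (a b c d : ℝ) (h : a * d - b * c = 1) (z : ℍ) :
    (moebius a b c d h • z).re =
      ((a * z.re + b) * (c * z.re + d) + a * c * z.im ^ 2) /
        ((c * z.re + d) ^ 2 + (c * z.im) ^ 2) := by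
  rw [← UpperHalfPlane.coe_re, UpperHalfPlane.coe_specialLinearGroup_apply, Complex.div_re]
  simp [moebius, Complex.normSq_apply]
  ring

/-- Two points can be moved to the imaginary axis. -/
lemma exists_smul_re_eq_zero (x y : ℍ) : ∃ g : Matrix.SpecialLinearGroup (Fin 2) ℝ,
    (g • x).re = 0 ∧ (g • y).re = 0 := by
  by_cases h : x.re = y.re
  · refine ⟨moebius 1 (-x.re) 0 1 (by ring), ?_, ?_⟩ <;> rw [moebius_smul_re] <;> simp [h]
  -- `x` and `y` lie on the circle with centre `c` and radius `R`, with the end point `c + R`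
  have h' : x.re - y.re ≠ 0 := sub_ne_zero.2 h
  obtain ⟨c, hc⟩ : ∃ c, c = (x.re ^ 2 + x.im ^ 2 - y.re ^ 2 - y.im ^ 2) / (2 * (x.re - y.re)) :=
    ⟨_, rfl⟩
  have hcc : 2 * c * (x.re - y.re) = x.re ^ 2 + x.im ^ 2 - y.re ^ 2 - y.im ^ 2 := by
    rw [hc]; field_simp
  obtain ⟨R, hR, hRx⟩ : ∃ R, 0 < R ∧ R ^ 2 = (x.re - c) ^ 2 + x.im ^ 2 := by
    have := x.im_pos
    exact ⟨√((x.re - c) ^ 2 + x.im ^ 2), Real.sqrt_pos.2 (by positivity),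
      Real.sq_sqrt (by positivity)⟩
  have hRy : R ^ 2 = (y.re - c) ^ 2 + y.im ^ 2 := by linarith
  refine ⟨moebius (-1 / (2 * R)) (-1 + (c + R) / (2 * R)) 1 (-(c + R)) ?_, ?_, ?_⟩
  · field_simp; ring
  · rw [moebius_smul_re, div_eq_zero_iff]
    left
    field_simp
    linear_combination hRx
  · rw [moebius_smul_re, div_eq_zero_iff]
    left
    field_simp
    linear_combination hRy

lemma areaBound_of_re_eq_zero {x y z : ℍ} (hxy : x ≠ y) (hyz : y ≠ z) (hxz : x ≠ z)
    (hx : x.re = 0) (hy : y.re = 0) : AreaBound x y z := by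
  have key : ∀ {x y z : ℍ}, x ≠ y → x.re = 0 → y.re = 0 → 0 < z.re → AreaBound x y z := by
    intro x y z hxy hx hy hz
    rcases lt_trichotomy x.im y.im with h | h | h
    · exact areaBound_vertical hx hy hz h
    · exact absurd (UpperHalfPlane.ext_re_im (hx.trans hy.symm) h) hxy
    · exact (areaBound_vertical hy hx hz h).swap
  rcases lt_trichotomy z.re 0 with h | h | h
  · -- `z ↦ -1 / z` exchanges the two sides of the imaginary axis
    apply AreaBound.of_smul (moebius 0 (-1) 1 0 (by ring))
    apply key
    · exact fun h => hxy (smul_left_cancel _ h)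
    · rw [moebius_smul_re]; simp [hx]
    · rw [moebius_smul_re]; simp [hy]
    · rw [moebius_smul_re]
      have := z.im_pos
      apply div_pos
      · simpa using h
      · simp; positivity
  · exact areaBound_imaginary_axis hxy hyz hxz hx hy h
  · exact key hxy hx hy h

/-- The area of a hyperbolic triangle is at most its angle defect. -/
theorem areaBound {x y z : ℍ} (hxy : x ≠ y) (hyz : y ≠ z) (hxz : x ≠ z) : AreaBound x y z := by
  obtain ⟨g, hx, hy⟩ := exists_smul_re_eq_zero x y
  apply AreaBound.of_smul g
  apply areaBound_of_re_eq_zero _ _ _ hx hy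
  all_goals intro h
  · exact hxy (smul_left_cancel _ h)
  · exact hyz (smul_left_cancel _ h)
  · exact hxz (smul_left_cancel _ h)

/-! ### Angles in the manifold -/

/-- Charts do not increase small distances: nearly shortest paths between nearby points stay in
the domain of the chart. -/
lemma GeneralHyperbolicManifold.exists_dist_chart_le {M : Type*} [MetricSpace M]
    (H : GeneralHyperbolicManifold M) {φ : HypChart M} (hφ : φ ∈ H.atlas) {p : M}
    (hp : p ∈ φ.source) : ∃ r > 0, ∀ x ∈ Metric.ball p r, ∀ y ∈ Metric.ball p r,
      dist (φ.toFun x) (φ.toFun y) ≤ dist x y := by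
  obtain ⟨ε, hε, hball⟩ := Metric.isOpen_iff.1 φ.isOpen_source p hp
  refine ⟨ε / 3, by positivity, fun x hx y hy => ?_⟩
  rw [← ENNReal.ofReal_le_ofReal_iff dist_nonneg, ← edist_dist, ← edist_dist]
  refine le_of_forall_gt_imp_ge_of_dense fun L hL => ?_
  rw [Metric.mem_ball] at hx hy
  have hxy : edist x y < ENNReal.ofReal (2 * ε / 3) := by
    rw [edist_dist, ENNReal.ofReal_lt_ofReal_iff (by positivity)]
    linarith [dist_triangle_right x y p]
  have hmin : edist x y < min L (ENNReal.ofReal (2 * ε / 3)) := lt_min hL hxy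
  rw [H.length_metric, iInf_lt_iff] at hmin
  obtain ⟨γ, hγ⟩ := hmin
  have hin : ∀ t, γ t ∈ φ.source := by
    intro t
    apply hball
    have h1 : edist (γ t) (γ 0) < ENNReal.ofReal (2 * ε / 3) :=
      (eVariationOn.edist_le (fun t => γ t) (mem_univ t) (mem_univ 0)).trans_lt
        (hγ.trans_le (min_le_right _ _))
    rw [γ.source, edist_dist, ENNReal.ofReal_lt_ofReal_iff (by positivity)] at h1
    rw [Metric.mem_ball]
    linarith [dist_triangle (γ t) x p]
  rw [H.length_chart φ hφ x y γ hin] at hγ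
  have h2 := eVariationOn.edist_le (fun t => φ.toFun (γ t)) (mem_univ 0) (mem_univ 1)
  simp only [γ.source, γ.target] at h2
  exact h2.trans (hγ.le.trans (min_le_left _ _))

/-- A map from a convex part of the hyperbolic plane that is isometric in charts preserves small
distances of `M`: the images of hyperbolic segments have the right length. -/
lemma exists_dist_eq_of_isLocalChartIsometryOn {M : Type*} [MetricSpace M]
    (H : GeneralHyperbolicManifold M) {f : ℍ → M} {S : Set ℍ} (hS : GeodConvex S)
    (hf : IsLocalChartIsometryOn H.atlas f S) {p : ℍ} (hp : p ∈ S) :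
    ∃ δ > 0, ∀ y ∈ S, ∀ z ∈ S, dist p y < δ → dist p z < δ → dist (f y) (f z) = dist y z := by
  obtain ⟨φ, hφ, W, hW, hsrc, hiso⟩ := hf p hp
  obtain ⟨ε, hε, hball⟩ := Metric.mem_nhds_iff.1 hW
  have hpW : p ∈ W ∩ S := ⟨mem_of_mem_nhds hW, hp⟩
  -- the image of the segment from `y` to `z` is a path of length `dist y z`
  have hle : ∀ y ∈ S, ∀ z ∈ S, dist p y < ε / 3 → dist p z < ε / 3 →
      dist (f y) (f z) ≤ dist y z := by
    intro y hy z hz hpy hpz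
    set d := dist y z with hd
    have hd0 : 0 ≤ d := dist_nonneg
    have hIcc : ∀ t : unitInterval, (t : ℝ) * d ∈ Icc 0 d := fun t =>
      ⟨mul_nonneg t.2.1 hd0, mul_le_of_le_one_left hd0 t.2.2⟩
    have hmem : ∀ t : unitInterval, geodPoint y z (t * d) ∈ W ∩ S := by
      intro t
      refine ⟨hball ?_, hS y hy z hz (geodPoint_mem_geodSegment (hIcc t))⟩
      rw [Metric.mem_ball, dist_comm]
      have h1 := (geodPoint_spec (hIcc t)).1
      have h2 := (hIcc t).2
      linarith [dist_triangle p y (geodPoint y z (t * d)), dist_triangle_left y z p]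
    have hdist : ∀ s t : unitInterval, dist (φ.toFun (f (geodPoint y z (s * d))))
        (φ.toFun (f (geodPoint y z (t * d)))) = dist ((s : ℝ) * d) (t * d) := by
      intro s t
      rw [hiso _ (hmem s) _ (hmem t), dist_geodPoint (hIcc s) (hIcc t), Real.dist_eq]
    have hcont : Continuous fun t : unitInterval => f (geodPoint y z (t * d)) := by
      have h1 : Continuous fun t : unitInterval =>
          (⟨f (geodPoint y z (t * d)), hsrc _ (hmem t)⟩ : φ.source) := by
        rw [φ.isEmbedding.isInducing.continuous_iff]
        have hc : Continuous fun t : unitInterval => (t : ℝ) * d := by fun_prop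
        rw [Metric.continuous_iff] at hc ⊢
        intro t η hη
        obtain ⟨ρ, hρ, h⟩ := hc t η hη
        refine ⟨ρ, hρ, fun s hs => ?_⟩
        have := h s hs
        rw [← hdist] at this
        exact this
      exact continuous_subtype_val.comp h1
    let γ : Path (f y) (f z) :=
      { toFun := fun t => f (geodPoint y z (t * d))
        continuous_toFun := hcont
        source' := by simp [geodPoint_zero]
        target' := by
          have := (geodPoint_spec (x := y) (y := z) (s := d) ⟨hd0, le_rfl⟩).2
          rw [← hd, sub_self, dist_eq_zero] at this
          simp [this] }
    have hlen := H.length_chart φ hφ _ _ γ (fun t => hsrc _ (hmem t))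
    have hvar : eVariationOn (fun t => φ.toFun (γ t)) univ ≤ ENNReal.ofReal d := by
      have e : eVariationOn (fun t => φ.toFun (γ t)) univ
          = eVariationOn (fun t : unitInterval => (t : ℝ) * d) univ := by
        unfold eVariationOn
        simp only [edist_dist]
        congr 1; funext p; congr 1; funext i
        congr 1
        exact hdist _ _
      have hmono : MonotoneOn (fun t : unitInterval => (t : ℝ) * d) univ :=
        fun s _ t _ hst => mul_le_mul_of_nonneg_right hst hd0
      have := hmono.eVariationOn_eq (mem_univ 0) (mem_univ 1)
      rw [univ_inter, show Icc (0 : unitInterval) 1 = univ from Icc_bot_top] at this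
      rw [e, this]
      simp
    have h3 : edist (f y) (f z) ≤ ENNReal.ofReal d := by
      rw [H.length_metric]
      exact (iInf_le _ γ).trans (hlen.le.trans hvar)
    rw [edist_dist] at h3
    exact (ENNReal.ofReal_le_ofReal_iff hd0).1 h3
  -- the opposite inequality: the chart does not increase distances near `f p`
  obtain ⟨r, hr, hchart⟩ := H.exists_dist_chart_le hφ (hsrc p hpW)
  refine ⟨min (ε / 3) r, by positivity, fun y hy z hz hpy hpz => ?_⟩
  rw [lt_min_iff] at hpy hpz
  refine le_antisymm (hle y hy z hz hpy.1 hpz.1) ?_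
  have hin : ∀ w ∈ S, dist p w < ε / 3 → dist p w < r → w ∈ W ∩ S ∧ f w ∈ Metric.ball (f p) r := by
    intro w hw h1 h2
    refine ⟨⟨hball ?_, hw⟩, ?_⟩
    · rw [Metric.mem_ball, dist_comm]; linarith
    · rw [Metric.mem_ball, dist_comm]
      exact (hle p hp w hw (by rw [dist_self]; positivity) h1).trans_lt h2
  obtain ⟨hyW, hyr⟩ := hin y hy hpy.1 hpy.2
  obtain ⟨hzW, hzr⟩ := hin z hz hpz.1 hpz.2
  rw [← hiso y hyW z hzW]
  exact hchart _ hyr _ hzr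

/-- The other side of the same triangle at the initial corner of `d`.  As the three corners add up
to `0` in `Fin 3`, the third corner is `-(a + b)`. -/
def Side.other {F : Type*} (d : Side F) : Side F :=
  ⟨d.t, d.a, -(d.a + d.b), by
    obtain ⟨t, a, b, h⟩ := d
    revert a b
    simp only
    decide⟩

lemma Side.other_corner {F : Type*} (d : Side F) : d.other.corner = d.corner := rfl

lemma Side.other_other {F : Type*} (d : Side F) : d.other.other = d := by
  obtain ⟨t, a, b, h⟩ := d
  simp [Side.other]

lemma Side.other_ne {F : Type*} (d : Side F) : d.other ≠ d := by
  obtain ⟨t, a, b, h⟩ := d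
  simp only [Side.other, ne_eq, Side.mk.injEq, true_and]
  revert a b
  decide

lemma Side.eq_or_eq_other {F : Type*} {d d' : Side F} (h : d'.corner = d.corner) :
    d' = d ∨ d' = d.other := by
  obtain ⟨t, a, b, hab⟩ := d
  obtain ⟨t', a', b', hab'⟩ := d'
  simp only [Side.corner, Prod.mk.injEq] at h
  obtain ⟨rfl, rfl⟩ := h
  simp only [Side.other, Side.mk.injEq, true_and]
  revert a' b b'
  decide

namespace TriangulatedMap

variable {F : Type*} {K : TriSurface F} {M : Type*} [MetricSpace M]
  {H : GeneralHyperbolicManifold M} (f : TriangulatedMap K H)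

lemma vertex_ne (d : Side F) : f.vertex d.t d.a ≠ f.vertex d.t d.b :=
  fun h => d.ne (f.injective d.t h)

lemma sideLength_pos (d : Side F) : 0 < f.sideLength d := dist_pos.2 (f.vertex_ne d)

/-- The side `d` in the hyperbolic plane. -/
def planePath (d : Side F) : ℝ → ℍ := geodPoint (f.vertex d.t d.a) (f.vertex d.t d.b)

lemma planePath_zero (d : Side F) : f.planePath d 0 = f.vertex d.t d.a := geodPoint_zero _ _

lemma planePath_mem (d : Side F) {s : ℝ} (hs : s ∈ Icc 0 (f.sideLength d)) :
    f.planePath d s ∈ geodHull (range (f.vertex d.t)) :=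
  geodConvex_geodHull _ _ (subset_geodHull _ (mem_range_self _)) _
    (subset_geodHull _ (mem_range_self _)) (geodPoint_mem_geodSegment hs)

lemma dist_planePath (d : Side F) {s : ℝ} (hs : s ∈ Icc 0 (f.sideLength d)) :
    dist (f.vertex d.t d.a) (f.planePath d s) = s := (geodPoint_spec hs).1

lemma eventually_mem_Icc (d : Side F) {δ : ℝ} (hδ : 0 < δ) :
    ∀ᶠ s in 𝓝[>] (0 : ℝ), s ∈ Icc 0 (f.sideLength d) ∧ s < δ := by
  filter_upwards [Ioo_mem_nhdsGT (lt_min (f.sideLength_pos d) hδ)] with s hs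
  exact ⟨⟨hs.1.le, (hs.2.trans_le (min_le_left _ _)).le⟩, hs.2.trans_le (min_le_right _ _)⟩

/-- Near a corner, the map of a triangle preserves the distances of `M`. -/
lemma exists_dist_toFun_eq (c : F × Fin 3) : ∃ δ > 0,
    ∀ y ∈ geodHull (range (f.vertex c.1)), ∀ z ∈ geodHull (range (f.vertex c.1)),
      dist (f.vertex c.1 c.2) y < δ → dist (f.vertex c.1 c.2) z < δ →
        dist (f.toFun c.1 y) (f.toFun c.1 z) = dist y z :=
  exists_dist_eq_of_isLocalChartIsometryOn H (geodConvex_geodHull _) (f.isometric c.1)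
    (subset_geodHull _ (mem_range_self _))

/-- Sides are geodesics of `M` near their initial points. -/
lemma eventually_dist_sidePath (d : Side F) :
    ∀ᶠ s in 𝓝[>] (0 : ℝ), dist (f.sidePath d 0) (f.sidePath d s) = s := by
  obtain ⟨δ, hδ, h⟩ := f.exists_dist_toFun_eq d.corner
  filter_upwards [f.eventually_mem_Icc d hδ] with s hs
  have h0 : (0 : ℝ) ∈ Icc 0 (f.sideLength d) := ⟨le_rfl, (f.sideLength_pos d).le⟩
  have := h _ (f.planePath_mem d h0) _ (f.planePath_mem d hs.1)
    (by rw [Side.corner, f.dist_planePath d h0]; exact hδ)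
    (by rw [Side.corner, f.dist_planePath d hs.1]; exact hs.2)
  rw [planePath_zero, f.dist_planePath d hs.1, ← f.planePath_zero d] at this
  exact this

/-- The sides of a triangle enclose the same angle in `M` as in the hyperbolic plane. -/
lemma upperAngle_sidePath_other (d : Side F) :
    upperAngle (f.sidePath d) (f.sidePath d.other) = f.cornerAngle d.corner := by
  have h1 : upperAngle (f.sidePath d) (f.sidePath d.other)
      = upperAngle (f.planePath d) (f.planePath d.other) := by
    obtain ⟨δ, hδ, h⟩ := f.exists_dist_toFun_eq d.corner
    have h0 : (0 : ℝ) ∈ Icc 0 (f.sideLength d) := ⟨le_rfl, (f.sideLength_pos d).le⟩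
    have key : ∀ (d₁ d₂ : Side F) (s t : ℝ), d₁.corner = d.corner → d₂.corner = d.corner →
        s ∈ Icc 0 (f.sideLength d₁) ∧ s < δ → t ∈ Icc 0 (f.sideLength d₂) ∧ t < δ →
        dist (f.sidePath d₁ s) (f.sidePath d₂ t) = dist (f.planePath d₁ s) (f.planePath d₂ t) := by
      intro d₁ d₂ s t hd₁ hd₂ hs ht
      unfold sidePath planePath
      obtain ⟨t₁, a₁, b₁, n₁⟩ := d₁
      obtain ⟨t₂, a₂, b₂, n₂⟩ := d₂
      simp only [Side.corner, Prod.mk.injEq] at hd₁ hd₂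
      obtain ⟨rfl, rfl⟩ := hd₁
      obtain ⟨rfl, rfl⟩ := hd₂
      exact h _ (f.planePath_mem ⟨_, _, b₁, n₁⟩ hs.1) _ (f.planePath_mem ⟨_, _, b₂, n₂⟩ ht.1)
        ((f.dist_planePath ⟨_, _, b₁, n₁⟩ hs.1).trans_lt hs.2)
        ((f.dist_planePath ⟨_, _, b₂, n₂⟩ ht.1).trans_lt ht.2)
    have e1 := f.eventually_mem_Icc d hδ
    have e2 := f.eventually_mem_Icc d.other hδ
    apply upperAngle_congr
    · filter_upwards [e1] with s hs using key d d 0 s rfl rfl ⟨h0, hδ⟩ hs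
    · filter_upwards [e2] with s hs using key d d.other 0 s rfl rfl ⟨h0, hδ⟩ hs
    · filter_upwards [e1.prod_mk e2] with t ht using key d d.other t.1 t.2 rfl rfl ht.1 ht.2
  rw [h1]
  obtain ⟨t, a, b, hab⟩ := d
  have : b = a + 1 ∧ -(a + b) = a + 2 ∨ b = a + 2 ∧ -(a + b) = a + 1 := by
    clear h1; revert a b; decide
  unfold cornerAngle planePath Side.other Side.corner
  rcases this with ⟨h, h'⟩ | ⟨h, h'⟩
  · simp only [h']; simp only [h]
  · simp only [h']; simp only [h]
    exact upperAngle_comm ((geodPoint_zero _ _).trans (geodPoint_zero _ _).symm)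

lemma sidePath_glue (d : Side F) {s : ℝ} (hs : s ∈ Icc 0 (f.sideLength d)) :
    f.sidePath (K.glue d) s = f.sidePath d s := f.glue_map d s hs

lemma sidePath_glue_zero (d : Side F) : f.sidePath (K.glue d) 0 = f.sidePath d 0 :=
  f.sidePath_glue d ⟨le_rfl, (f.sideLength_pos d).le⟩

lemma sidePath_other_zero (d : Side F) : f.sidePath d.other 0 = f.sidePath d 0 := by
  unfold sidePath
  rw [geodPoint_zero, geodPoint_zero]; rfl

lemma upperAngle_sidePath_glue (c : ℝ → M) (d : Side F) :
    upperAngle c (f.sidePath (K.glue d)) = upperAngle c (f.sidePath d) := by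
  have e := (f.eventually_mem_Icc d one_pos).mono fun s hs => f.sidePath_glue d hs.1
  apply upperAngle_congr
  · exact Eventually.of_forall fun _ => rfl
  · filter_upwards [e] with s hs using by rw [hs]
  · filter_upwards [tendsto_snd.eventually e] with t ht using by rw [ht]

end TriangulatedMap

/-! ### The sides around a vertex -/

namespace TriSurface

variable {F : Type*} (K : TriSurface F)

/-- Turning around a vertex: cross the triangle of `d` to its other side at the corner, and pass to
the neighbouring triangle. -/
def turn (d : Side F) : Side F := K.glue d.other

lemma glue_injective : Function.Injective K.glue := Function.LeftInverse.injective K.glue_glue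

lemma turn_injective : Function.Injective K.turn := by
  intro d d' h
  have := congrArg Side.other (K.glue_injective h)
  rwa [Side.other_other, Side.other_other] at this

lemma turn_glue_turn (d : Side F) : K.turn (K.glue (K.turn d)) = K.glue d := by
  unfold turn; rw [K.glue_glue, Side.other_other]

/-- Gluing reverses the direction of turning. -/
lemma turn_iterate_glue (m : ℕ) (d : Side F) : K.turn^[m] (K.glue (K.turn^[m] d)) = K.glue d := by
  induction m generalizing d with
  | zero => rfl
  | succ m ih =>
    rw [Function.iterate_succ_apply', Function.iterate_succ_apply, ih, turn_glue_turn]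

lemma vertexAt_glue (d : Side F) : K.vertexAt (K.glue d).corner = K.vertexAt d.corner :=
  (Quot.sound ⟨d, rfl, rfl⟩).symm

lemma vertexAt_turn_iterate (m : ℕ) (d : Side F) :
    K.vertexAt (K.turn^[m] d).corner = K.vertexAt d.corner := by
  induction m with
  | zero => rfl
  | succ m ih =>
    rw [Function.iterate_succ_apply', turn, vertexAt_glue, Side.other_corner, ih]

/-- Turning from a boundary side reaches all corners at its vertex. -/
lemma exists_turn_iterate_corner {e : Side F} (he : K.IsBoundary e) {c : F × Fin 3}
    (h : K.vertexAt c = K.vertexAt e.corner) : ∃ m, (K.turn^[m] e).corner = c := by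
  have step : ∀ d : Side F, (∃ m, (K.turn^[m] e).corner = d.corner) →
      ∃ m, (K.turn^[m] e).corner = (K.glue d).corner := by
    rintro d ⟨m, hm⟩
    rcases Side.eq_or_eq_other hm.symm with h | h
    · rcases m with _ | m
      · refine ⟨0, ?_⟩
        rw [h]
        exact congrArg Side.corner he.symm
      · refine ⟨m, ?_⟩
        rw [h, Function.iterate_succ_apply', turn, K.glue_glue, Side.other_corner]
    · refine ⟨m + 1, ?_⟩
      rw [h, Function.iterate_succ_apply', turn]
  -- being reached is a property of the vertex, as it is invariant under gluing
  let P : K.Vertex → Prop := Quot.lift (fun c => ∃ m, (K.turn^[m] e).corner = c) (by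
    rintro c c' ⟨d, rfl, rfl⟩
    apply propext
    refine ⟨step d, fun h => ?_⟩
    have := step _ h
    rwa [K.glue_glue] at this)
  have h1 : P (K.vertexAt e.corner) := ⟨0, rfl⟩
  rw [← h] at h1
  exact h1

lemma exists_turn_iterate_eq {e e' : Side F} {v : K.Vertex} (he : e ∈ K.boundaryAt v)
    (he' : e' ∈ K.boundaryAt v) : ∃ m, K.turn^[m] e = e' := by
  obtain ⟨m, hm⟩ := K.exists_turn_iterate_corner he.1 (he'.2.trans he.2.symm)
  rcases Side.eq_or_eq_other hm.symm with h | h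
  · exact ⟨m, h.symm⟩
  · refine ⟨m + 1, ?_⟩
    rw [Function.iterate_succ_apply', turn, ← h]
    exact he'.1

/-- On the shortest way from one boundary side at a vertex to another, no corner is visited
twice. -/
lemma injOn_turn_iterate_corner {e e' : Side F} (he : K.IsBoundary e) (he' : K.IsBoundary e')
    {k : ℕ} (hk : K.turn^[k] e = e') (hmin : ∀ m < k, K.turn^[m] e ≠ e') :
    InjOn (fun m => (K.turn^[m] e).corner) (Finset.range k) := by
  -- by minimality of `k`, the side `e` does not recur on the way
  have hper : ∀ n, 0 < n → n ≤ k → K.turn^[n] e ≠ e := by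
    intro n hn hnk h
    apply hmin (k - n) (by omega)
    rw [← hk]
    conv_rhs => rw [← Nat.sub_add_cancel hnk, Function.iterate_add_apply, h]
  -- turning back from `e'` leads to `e`, so `2 k` turns are a full period
  have h2k : K.turn^[k + k] e = e := by
    have := K.turn_iterate_glue k e
    rwa [hk, he', he, ← hk, ← Function.iterate_add_apply] at this
  have key : ∀ i j, i < j → j < k → (K.turn^[i] e).corner ≠ (K.turn^[j] e).corner := by
    intro i j hij hjk hc
    rcases Side.eq_or_eq_other hc with h | h
    · apply hper (j - i) (by omega) (by omega)
      apply K.turn_injective.iterate i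
      rw [← Function.iterate_add_apply, Nat.add_sub_cancel' hij.le, h]
    · -- the side `j` is the other side at the corner of the side `i`: turning back from it leads
      -- from `i + 1` to `e`
      have h1 : K.turn^[j + (i + 1)] e = e := by
        have h2 : K.turn^[i + 1] e = K.glue (K.turn^[j] e) := by
          rw [Function.iterate_succ_apply', turn, h, Side.other_other]
        rw [Function.iterate_add_apply, h2, turn_iterate_glue]
        exact he
      by_cases hn : j + (i + 1) ≤ k
      · exact hper _ (by omega) hn h1
      · apply hper (k + k - (j + (i + 1))) (by omega) (by omega)
        conv_lhs => rw [← h1, ← Function.iterate_add_apply,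
          Nat.sub_add_cancel (show j + (i + 1) ≤ k + k by omega)]
        exact h2k
  intro i hi j hj hij
  simp only [Finset.coe_range, mem_Iio] at hi hj
  rcases lt_trichotomy i j with h | h | h
  · exact absurd hij (key i j h hj)
  · exact h
  · exact absurd hij.symm (key j i h hi)

end TriSurface

namespace TriangulatedMap

variable {F : Type*} {K : TriSurface F} {M : Type*} [MetricSpace M]
  {H : GeneralHyperbolicManifold M} (f : TriangulatedMap K H)

lemma cornerAngle_nonneg (c : F × Fin 3) : 0 ≤ f.cornerAngle c := upperAngle_nonneg _ _

lemma upperAngle_sidePath_turn (d : Side F) :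
    upperAngle (f.sidePath d) (f.sidePath (K.turn d)) = f.cornerAngle d.corner := by
  rw [TriSurface.turn, upperAngle_sidePath_glue, upperAngle_sidePath_other]

lemma sidePath_turn_iterate_zero (d : Side F) (m : ℕ) :
    f.sidePath (K.turn^[m] d) 0 = f.sidePath d 0 := by
  induction m with
  | zero => rfl
  | succ m ih =>
    rw [Function.iterate_succ_apply', TriSurface.turn, sidePath_glue_zero, sidePath_other_zero, ih]

lemma upperAngle_sidePath_turn_iterate_le (d : Side F) (m : ℕ) :
    upperAngle (f.sidePath d) (f.sidePath (K.turn^[m + 1] d))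
      ≤ ∑ i ∈ Finset.range (m + 1), f.cornerAngle (K.turn^[i] d).corner := by
  induction m with
  | zero =>
    rw [zero_add, Finset.sum_range_one]
    exact (f.upperAngle_sidePath_turn d).le
  | succ m ih =>
    rw [Finset.sum_range_succ, ← upperAngle_sidePath_turn,
      ← Function.iterate_succ_apply' K.turn]
    refine (upperAngle_triangle (c₂ := f.sidePath (K.turn^[m + 1] d)) ?_ ?_
      (f.eventually_dist_sidePath _) (f.eventually_dist_sidePath _)
      (f.eventually_dist_sidePath _)).trans (by gcongr)
    · exact (f.sidePath_turn_iterate_zero _ _).symm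
    · rw [sidePath_turn_iterate_zero, sidePath_turn_iterate_zero]

/-- The angle in `M` between the boundary sides at a vertex is at most the sum of the angles of
the triangles around the vertex. -/
theorem upperAngle_le_angleSum [Fintype F] {v : K.Vertex} {e e' : Side F}
    (he : e ∈ K.boundaryAt v) (he' : e' ∈ K.boundaryAt v) (hne : e ≠ e') :
    upperAngle (f.sidePath e) (f.sidePath e') ≤ f.angleSum v := by
  classical
  have hex := K.exists_turn_iterate_eq he he'
  have hk := Nat.find_spec hex
  have hmin := fun m (hm : m < Nat.find hex) => Nat.find_min hex hm
  generalize Nat.find hex = k at hk hmin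
  have hinj := K.injOn_turn_iterate_corner he.1 he'.1 hk hmin
  rcases k with _ | k
  · exact absurd hk hne
  rw [← hk]
  refine (f.upperAngle_sidePath_turn_iterate_le e k).trans ?_
  unfold angleSum
  rw [← Finset.sum_filter, ← Finset.sum_image hinj]
  apply Finset.sum_le_sum_of_subset_of_nonneg
  · intro c hc
    obtain ⟨i, -, rfl⟩ := Finset.mem_image.1 hc
    rw [Finset.mem_filter, K.vertexAt_turn_iterate]
    exact ⟨Finset.mem_univ _, he.2⟩
  · exact fun c _ _ => f.cornerAngle_nonneg c

end TriangulatedMap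

/-! ### Counting vertices and edges -/

/-- A directed side is a triangle with an ordered pair of distinct corners. -/
def Side.equiv (F : Type*) : Side F ≃ F × {p : Fin 3 × Fin 3 // p.1 ≠ p.2} where
  toFun d := (d.t, ⟨(d.a, d.b), d.ne⟩)
  invFun x := ⟨x.1, x.2.1.1, x.2.1.2, x.2.2⟩
  left_inv _ := rfl
  right_inv _ := rfl

instance (F : Type*) [Fintype F] : Fintype (Side F) := Fintype.ofEquiv _ (Side.equiv F).symm

lemma Side.card (F : Type*) [Fintype F] : Fintype.card (Side F) = 6 * Fintype.card F := by
  rw [Fintype.card_congr (Side.equiv F), Fintype.card_prod, mul_comm]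
  congr 1

lemma Side.rev_rev {F : Type*} (d : Side F) : d.rev.rev = d := rfl

lemma Side.rev_ne {F : Type*} (d : Side F) : d.rev ≠ d := by
  intro h
  exact d.ne (congrArg Side.b h)

namespace TriSurface

variable {F : Type*} (K : TriSurface F)

instance [Finite F] : Finite K.Vertex := inferInstanceAs (Finite (Quot _))

instance [Finite F] : Finite K.Edge := by
  have := Fintype.ofFinite F
  exact inferInstanceAs (Finite (Quot _))

/-- The edge of the surface that contains a side. -/
def edgeAt (d : Side F) : K.Edge := Quot.mk _ d

open Classical in
/-- The directed sides that are identified with `d` up to direction. -/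
def edgeSides (d : Side F) : Finset (Side F) := {d, d.rev, K.glue d, (K.glue d).rev}

lemma mem_edgeSides {d d' : Side F} : d' ∈ K.edgeSides d ↔
    d' = d ∨ d' = d.rev ∨ d' = K.glue d ∨ d' = (K.glue d).rev := by
  simp [edgeSides]

lemma edgeSides_rev (d : Side F) : K.edgeSides d.rev = K.edgeSides d := by
  ext x; simp only [mem_edgeSides, K.glue_rev, Side.rev_rev]; tauto

lemma edgeSides_glue (d : Side F) : K.edgeSides (K.glue d) = K.edgeSides d := by
  ext x; simp only [mem_edgeSides, K.glue_glue]; tauto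

lemma edgeAt_rev (d : Side F) : K.edgeAt d.rev = K.edgeAt d :=
  Eq.symm (Quot.sound (r := fun d d' : Side F => d' = d.rev ∨ d' = K.glue d) (Or.inl rfl))

lemma edgeAt_glue (d : Side F) : K.edgeAt (K.glue d) = K.edgeAt d :=
  Eq.symm (Quot.sound (r := fun d d' : Side F => d' = d.rev ∨ d' = K.glue d) (Or.inr rfl))

lemma edgeAt_eq_iff {d d' : Side F} : K.edgeAt d' = K.edgeAt d ↔ d' ∈ K.edgeSides d := by
  constructor
  · intro h
    let P : K.Edge → Finset (Side F) := Quot.lift K.edgeSides (by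
      rintro d _ (rfl | rfl)
      · exact (K.edgeSides_rev d).symm
      · exact (K.edgeSides_glue d).symm)
    have h1 : K.edgeSides d' = K.edgeSides d := congrArg P h
    rw [← h1, mem_edgeSides]
    exact Or.inl rfl
  · rw [mem_edgeSides]
    rintro (rfl | rfl | rfl | rfl)
    · rfl
    · exact K.edgeAt_rev d
    · exact K.edgeAt_glue d
    · rw [edgeAt_rev, edgeAt_glue]

open Classical in
/-- The directed boundary sides. -/
def boundarySides [Fintype F] : Finset (Side F) := {d | K.IsBoundary d}

open Classical in
/-- Every edge consists of four directed sides, where boundary sides count twice. -/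
lemma four_mul_card_edge [Fintype F] :
    4 * Nat.card K.Edge = 6 * Fintype.card F + K.boundarySides.card := by
  have := Fintype.ofFinite K.Edge
  have h1 : 6 * Fintype.card F + K.boundarySides.card
      = ∑ d : Side F, (1 + if K.IsBoundary d then 1 else 0) := by
    rw [Finset.sum_add_distrib, ← Finset.card_eq_sum_ones, Finset.card_univ, Side.card,
      ← Finset.card_filter]
    rfl
  rw [h1, ← Finset.sum_fiberwise (g := K.edgeAt), Nat.card_eq_fintype_card, mul_comm,
    ← smul_eq_mul, ← Finset.card_univ, ← Finset.sum_const]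
  refine Finset.sum_congr rfl fun x _ => ?_
  obtain ⟨d, rfl⟩ := Quot.exists_rep x
  have e : (Finset.univ.filter fun d' => K.edgeAt d' = Quot.mk _ d) = K.edgeSides d := by
    ext d'
    rw [Finset.mem_filter]
    exact ⟨fun h => K.edgeAt_eq_iff.1 h.2, fun h => ⟨Finset.mem_univ _, K.edgeAt_eq_iff.2 h⟩⟩
  rw [e]
  have hr := d.rev_ne
  have hr' := (K.glue d).rev_ne
  have hg := K.glue_ne_rev d
  by_cases hd : K.glue d = d
  · have e2 : K.edgeSides d = {d, d.rev} := by
      ext x; simp only [mem_edgeSides, hd, Finset.mem_insert, Finset.mem_singleton]; tauto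
    have hd' : K.IsBoundary d.rev := by rw [IsBoundary, K.glue_rev, hd]
    rw [e2, Finset.sum_pair hr.symm, if_pos (show K.IsBoundary d from hd), if_pos hd']
  · have hd2 : ¬ K.IsBoundary (K.glue d) := fun h => hd (by
      have h' : K.glue (K.glue d) = K.glue d := h
      rw [K.glue_glue] at h'
      exact h'.symm)
    have hrev : ∀ x : Side F, ¬ K.IsBoundary x → ¬ K.IsBoundary x.rev := fun x hx h => hx (by
      have h' : K.glue x.rev = x.rev := h
      rw [K.glue_rev] at h'
      exact congrArg Side.rev h')
    have hne : (K.glue d).rev ≠ d := fun h => hg (congrArg Side.rev h)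
    have hne' : (K.glue d).rev ≠ d.rev := fun h => hd (congrArg Side.rev h)
    have hcard : (K.edgeSides d).card = 4 := by
      unfold edgeSides
      rw [Finset.card_insert_of_notMem, Finset.card_insert_of_notMem,
        Finset.card_insert_of_notMem, Finset.card_singleton]
      · simpa using hr'.symm
      · simp only [Finset.mem_insert, Finset.mem_singleton, not_or]
        exact ⟨hg.symm, hne'.symm⟩
      · simp only [Finset.mem_insert, Finset.mem_singleton, not_or]
        exact ⟨hr.symm, fun h => hd h.symm, hne.symm⟩
    have e3 : ∀ x ∈ K.edgeSides d, (1 + if K.IsBoundary x then 1 else 0) = 1 := by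
      intro x hx
      rw [if_neg]
      rw [mem_edgeSides] at hx
      rcases hx with rfl | rfl | rfl | rfl
      · exact hd
      · exact hrev _ hd
      · exact hd2
      · exact hrev _ hd2
    rw [Finset.sum_congr rfl e3, Finset.sum_const, hcard]
    rfl

open Classical in
/-- The number of boundary sides issuing from a vertex is even: among the sides at the vertex,
`Side.other` has no fixed points, and the fixed points of gluing are the boundary sides. -/
lemma even_card_boundaryAt [Fintype F] (v : K.Vertex) :
    Even (K.boundarySides.filter fun d => K.vertexAt d.corner = v).card := by
  set A : Finset (Side F) := Finset.univ.filter fun d => K.vertexAt d.corner = v with hA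
  have h1 : ((A.card : ℕ) : ZMod 2) = 0 := by
    rw [Finset.cast_card]
    refine Finset.sum_involution (fun d _ => d.other) (fun d _ => by decide)
      (fun d _ _ => d.other_ne) (fun d hd => ?_) (fun d _ => d.other_other)
    simpa [hA, Side.other_corner] using hd
  have h2 : (((A.filter fun d => ¬ K.IsBoundary d).card : ℕ) : ZMod 2) = 0 := by
    rw [Finset.cast_card]
    refine Finset.sum_involution (fun d _ => K.glue d) (fun d _ => by decide)
      (fun d hd _ => (Finset.mem_filter.1 hd).2) (fun d hd => ?_) (fun d _ => K.glue_glue d)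
    simp only [hA, Finset.mem_filter, Finset.mem_univ, true_and, vertexAt_glue] at hd ⊢
    refine ⟨hd.1, fun h => hd.2 ?_⟩
    have h' : K.glue (K.glue d) = K.glue d := h
    rw [K.glue_glue] at h'
    exact h'.symm
  rw [← Finset.card_filter_add_card_filter_not (s := A) (fun d => K.IsBoundary d), Nat.cast_add,
    h2, add_zero, ZMod.natCast_eq_zero_iff_even] at h1
  convert h1 using 2
  ext d
  simp [hA, boundarySides, and_comm]

open Classical in
/-- There are at least two boundary sides issuing from every boundary vertex. -/
lemma two_mul_card_boundary_le [Fintype F] [Fintype K.Vertex] :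
    2 * (Finset.univ.filter fun v => K.IsBoundaryVertex v).card ≤ K.boundarySides.card := by
  rw [Finset.card_eq_sum_card_fiberwise (f := fun d => K.vertexAt d.corner) (s := K.boundarySides)
    (t := Finset.univ.filter fun v => K.IsBoundaryVertex v), mul_comm, ← smul_eq_mul,
    ← Finset.sum_const]
  · refine Finset.sum_le_sum fun v hv => ?_
    obtain ⟨d, hd⟩ := (Finset.mem_filter.1 hv).2
    have hpos : 0 < (K.boundarySides.filter fun d => K.vertexAt d.corner = v).card := by
      apply Finset.card_pos.2
      refine ⟨d, Finset.mem_filter.2 ⟨?_, hd.2⟩⟩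
      simpa [boundarySides] using hd.1
    obtain ⟨m, hm⟩ := K.even_card_boundaryAt v
    omega
  · intro d hd
    have hd' : K.IsBoundary d := by simpa [boundarySides] using hd
    have hb : K.IsBoundaryVertex (K.vertexAt d.corner) := ⟨d, hd', rfl⟩
    simpa using hb

end TriSurface

/-! ### The Gauss–Bonnet inequality -/

namespace TriangulatedMap

variable {F : Type*} {K : TriSurface F} {M : Type*} [MetricSpace M]
  {H : GeneralHyperbolicManifold M} (f : TriangulatedMap K H)

lemma cornerAngle_le_hypAngle (t : F) (a : Fin 3) : f.cornerAngle (t, a) ≤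
    hypAngle (f.vertex t a) (f.vertex t (a + 1)) (f.vertex t (a + 2)) := by
  apply upperAngle_geodPoint_le
  · exact fun h => absurd (f.injective t h) (by clear h; dsimp only; revert a; decide)
  · exact fun h => absurd (f.injective t h) (by clear h; dsimp only; revert a; decide)

lemma area_triangle_le (t : F) : (volume (geodHull (range (f.vertex t)))).toReal
    ≤ π - ∑ a, f.cornerAngle (t, a) := by
  have hne : ∀ a b, a ≠ b → f.vertex t a ≠ f.vertex t b := fun a b h h' => h (f.injective t h')
  have h := areaBound (hne 0 1 (by decide)) (hne 1 2 (by decide)) (hne 0 2 (by decide))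
  have hr : range (f.vertex t) = {f.vertex t 0, f.vertex t 1, f.vertex t 2} := by
    ext z; simp [Fin.exists_fin_succ, eq_comm]
  rw [hr, Fin.sum_univ_three]
  refine (ENNReal.toReal_le_of_le_ofReal (by linarith [h.1]) h.2).trans ?_
  have h0 := f.cornerAngle_le_hypAngle t 0
  have h1 := f.cornerAngle_le_hypAngle t 1
  have h2 := f.cornerAngle_le_hypAngle t 2
  unfold hypAngleSum
  have e1 : (1 : Fin 3) + 1 = 2 := rfl
  have e2 : (1 : Fin 3) + 2 = 0 := rfl
  have e3 : (2 : Fin 3) + 1 = 0 := rfl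
  have e4 : (2 : Fin 3) + 2 = 1 := rfl
  rw [zero_add, zero_add] at h0
  rw [e1, e2] at h1
  rw [e3, e4] at h2
  linarith

lemma sum_angleSum [Fintype F] [Fintype K.Vertex] :
    ∑ v, f.angleSum v = ∑ t, ∑ a, f.cornerAngle (t, a) := by
  classical
  unfold angleSum
  rw [Finset.sum_comm, ← Fintype.sum_prod_type (f := f.cornerAngle)]
  exact Finset.sum_congr rfl fun c _ => by simp

/-- The Gauss–Bonnet inequality, with the exterior angles measured in the surface. -/
theorem area_le_sum_sub_angleSum [Fintype F] {n : ℕ} {v : Fin n → K.Vertex}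
    (hv : Function.Injective v) (hbd : ∀ i, K.IsBoundaryVertex (v i))
    (hf : f.IsHMap (range v)) :
    f.area ≤ (∑ i, (π - f.angleSum (v i))) - 2 * π * K.eulerChar := by
  classical
  have := Fintype.ofFinite K.Vertex
  have h1 : f.area ≤ Fintype.card F * π - ∑ w, f.angleSum w := by
    unfold area
    have e : (Fintype.card F * π : ℝ) = ∑ _t : F, π := by simp
    rw [sum_angleSum, e, ← Finset.sum_sub_distrib]
    exact Finset.sum_le_sum fun t _ => f.area_triangle_le t
  -- the angle conditions, as a lower bound for the angle sum that is uniform in the vertex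
  have h2 : ∀ w, (2 * π - (if K.IsBoundaryVertex w then π else 0))
      - (if w ∈ Finset.univ.image v then π - f.angleSum w else 0) ≤ f.angleSum w := by
    intro w
    by_cases hw : w ∈ Finset.univ.image v
    · obtain ⟨i, -, rfl⟩ := Finset.mem_image.1 hw
      rw [if_pos hw, if_pos (hbd i)]
      linarith
    · rw [if_neg hw]
      have hw' : w ∉ range v := by simpa using hw
      by_cases hb : K.IsBoundaryVertex w
      · rw [if_pos hb]; linarith [hf.2 w hb hw']
      · rw [if_neg hb]; linarith [hf.1 w hb]
  have h3 := Finset.sum_le_sum (s := (Finset.univ : Finset K.Vertex)) fun w _ => h2 w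
  rw [Finset.sum_sub_distrib, Finset.sum_sub_distrib, Finset.sum_const, Finset.card_univ,
    ← Finset.sum_filter (s := Finset.univ), Finset.sum_const, Finset.sum_ite_mem, Finset.univ_inter,
    Finset.sum_image hv.injOn, nsmul_eq_mul, nsmul_eq_mul] at h3
  have h4 : (4 : ℝ) * Nat.card K.Edge = 6 * Fintype.card F + K.boundarySides.card := by
    exact_mod_cast K.four_mul_card_edge
  have h5 : (2 : ℝ) * (Finset.univ.filter fun v => K.IsBoundaryVertex v).card
      ≤ K.boundarySides.card := by exact_mod_cast K.two_mul_card_boundary_le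
  have h6 : (K.eulerChar : ℝ) = Fintype.card K.Vertex - Nat.card K.Edge + Fintype.card F := by
    unfold TriSurface.eulerChar
    rw [Nat.card_eq_fintype_card (α := K.Vertex)]
    push_cast
    ring
  rw [h6]
  nlinarith [Real.pi_pos, mul_le_mul_of_nonneg_left h5 Real.pi_pos.le]

end TriangulatedMap

/-! ### The Euler characteristic of the disk -/

namespace TriSurface

variable {F : Type*} (K : TriSurface F)

/-- A simplicial 1-cocycle of the surface with coefficients in `R`, as a function of the directed
sides. -/
structure IsCocycle {R : Type*} [AddCommGroup R] (z : Side F → R) : Prop where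
  rev : ∀ d, z d.rev = -z d
  glue : ∀ d, z (K.glue d) = z d
  triangle : ∀ t, z ⟨t, 0, 1, by decide⟩ + z ⟨t, 1, 2, by decide⟩ + z ⟨t, 2, 0, by decide⟩ = 0

variable {K}

/-- A cocycle is the coboundary of a function on each triangle. -/
lemma IsCocycle.exists_potential {R : Type*} [AddCommGroup R] {z : Side F → R}
    (hz : K.IsCocycle z) (t : F) :
    ∃ w : Fin 3 → R, ∀ a b (h : a ≠ b), z ⟨t, a, b, h⟩ = w b - w a := by
  have h01 := hz.rev ⟨t, 0, 1, by decide⟩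
  have h12 := hz.rev ⟨t, 1, 2, by decide⟩
  have h20 := hz.rev ⟨t, 2, 0, by decide⟩
  have h := hz.triangle t
  simp only [Side.rev] at h01 h12 h20
  refine ⟨![0, z ⟨t, 0, 1, by decide⟩, -z ⟨t, 2, 0, by decide⟩], fun a b hab => ?_⟩
  have e : z ⟨t, 1, 2, by decide⟩ = -z ⟨t, 2, 0, by decide⟩ - z ⟨t, 0, 1, by decide⟩ := by
    rw [← sub_eq_zero, ← h]; abel
  fin_cases a <;> fin_cases b <;> first | exact absurd rfl hab | simp_all

variable (K)

/-- The point of the realization with the barycentric coordinates `x` in the triangle `t`. -/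
def trianglePoint (t : F) (x : stdSimplex ℝ (Fin 3)) : K.Realization := Quot.mk _ ⟨t, x⟩

lemma continuous_trianglePoint (t : F) : Continuous (K.trianglePoint t) :=
  continuous_coinduced_rng.comp continuous_sigmaMk

/-- The point of the realization at a vertex. -/
def vertexPoint : K.Vertex → K.Realization :=
  Quot.lift (fun c => K.trianglePoint c.1 ⟨Pi.single c.2 1, single_mem_stdSimplex ℝ c.2⟩) (by
    rintro _ _ ⟨d, rfl, rfl⟩
    refine Quot.sound ⟨d, 0, ⟨le_rfl, zero_le_one⟩, rfl, ?_, rfl, ?_⟩ <;> simp [Side.corner])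

variable {K}

/-- The map to the circle given by an integral cocycle: on each triangle it is the reduction modulo
`1` of the affine function whose coboundary is the cocycle. -/
lemma IsCocycle.exists_circle_map {z : Side F → ℤ} (hz : K.IsCocycle z) :
    ∃ (w : F → Fin 3 → ℤ) (Φ : K.Realization → AddCircle (1 : ℝ)), Continuous Φ ∧
      (∀ d : Side F, z d = w d.t d.b - w d.t d.a) ∧
      ∀ t (x : stdSimplex ℝ (Fin 3)), Φ (K.trianglePoint t x)
        = ((∑ a, (x : Fin 3 → ℝ) a * w t a : ℝ) : AddCircle (1 : ℝ)) := by
  choose w hw using hz.exists_potential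
  refine ⟨w, Quot.lift (fun x => ((∑ a, (x.2 : Fin 3 → ℝ) a * w x.1 a : ℝ) : AddCircle (1 : ℝ))) ?_,
    ?_, fun d => hw d.t d.a d.b d.ne, fun t x => rfl⟩
  · rintro ⟨t, x⟩ ⟨t', y⟩ ⟨d, s, -, ht, hx, ht', hy⟩
    simp only at ht hx ht' hy ⊢
    subst ht ht'
    -- modulo `1`, the affine function on the side `d` depends only on `s` and `z d`
    have key : ∀ d : Side F,
        ∑ a, ((1 - s) • Pi.single d.a (1 : ℝ) + s • Pi.single d.b 1 : Fin 3 → ℝ) a * w d.t a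
          = w d.t d.a + s * z d := by
      intro d
      have e : (z d : ℝ) = w d.t d.b - w d.t d.a := by exact_mod_cast hw d.t d.a d.b d.ne
      simp only [Pi.add_apply, Pi.smul_apply, smul_eq_mul, add_mul, Finset.sum_add_distrib,
        Pi.single_apply, mul_ite, ite_mul, mul_one, mul_zero, zero_mul, Finset.sum_ite_eq',
        Finset.mem_univ, if_true, e]
      ring
    rw [hx, hy, key, key, hz.glue, AddCircle.coe_add, AddCircle.coe_add]
    have int : ∀ n : ℤ, ((n : ℝ) : AddCircle (1 : ℝ)) = 0 := fun n =>
      (AddCircle.coe_eq_zero_iff 1).2 ⟨n, by simp⟩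
    rw [int, int]
  · refine continuous_coinduced_dom.2 (continuous_sigma fun t => ?_)
    change Continuous fun x : stdSimplex ℝ (Fin 3) =>
      ((∑ a, (x : Fin 3 → ℝ) a * w t a : ℝ) : AddCircle (1 : ℝ))
    refine (AddCircle.continuous_mk' 1).comp (continuous_finsetSum _ fun a _ => ?_)
    exact ((continuous_apply a).comp continuous_subtype_val).mul continuous_const

/-- Maps from a closed disk to the circle lift to the line. -/
lemma exists_lift_of_closedBall
    (Φ : C(Metric.closedBall (0 : EuclideanSpace ℝ (Fin 2)) 1, AddCircle (1 : ℝ))) :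
    ∃ U : Metric.closedBall (0 : EuclideanSpace ℝ (Fin 2)) 1 → ℝ, Continuous U ∧
      ∀ x, (U x : AddCircle (1 : ℝ)) = Φ x := by
  -- the plane retracts to the disk
  have hmem : ∀ x : EuclideanSpace ℝ (Fin 2),
      (max 1 ‖x‖)⁻¹ • x ∈ Metric.closedBall (0 : EuclideanSpace ℝ (Fin 2)) 1 := by
    intro x
    have h : 0 < max 1 ‖x‖ := lt_max_of_lt_left one_pos
    rw [mem_closedBall_zero_iff, norm_smul, norm_inv, Real.norm_of_nonneg h.le,
      inv_mul_le_iff₀ h, mul_one]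
    exact le_max_right _ _
  let r : C(EuclideanSpace ℝ (Fin 2), Metric.closedBall (0 : EuclideanSpace ℝ (Fin 2)) 1) :=
    ⟨fun x => ⟨(max 1 ‖x‖)⁻¹ • x, hmem x⟩, by
      refine Continuous.subtype_mk (Continuous.smul (Continuous.inv₀
        (continuous_const.max continuous_norm) fun x => ?_) continuous_id) _
      exact (lt_max_of_lt_left one_pos).ne'⟩
  obtain ⟨e, he⟩ := QuotientAddGroup.mk_surjective ((Φ.comp r) 0)
  obtain ⟨U, ⟨-, hU⟩, -⟩ := (AddCircle.isCoveringMap_coe (1 : ℝ)).existsUnique_continuousMap_lifts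
    (Φ.comp r) 0 e he
  refine ⟨fun x => U x, U.continuous.comp continuous_subtype_val, fun x => ?_⟩
  have h1 := congrFun hU x
  have h2 : r x = x := by
    apply Subtype.ext
    show (max 1 ‖(x : EuclideanSpace ℝ (Fin 2))‖)⁻¹ • (x : EuclideanSpace ℝ (Fin 2)) = x
    rw [max_eq_left (mem_closedBall_zero_iff.1 x.2), inv_one, one_smul]
  refine h1.trans ?_
  rw [ContinuousMap.comp_apply, h2]

/-- On a disk, integral cocycles are coboundaries. -/
lemma IsDisk.exists_coboundary_int (hK : K.IsDisk) {z : Side F → ℤ} (hz : K.IsCocycle z) :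
    ∃ u : K.Vertex → ℤ, ∀ d, z d = u (K.vertexAt d.rev.corner) - u (K.vertexAt d.corner) := by
  obtain ⟨h⟩ := hK
  obtain ⟨w, Φ, hΦ, hw, hΦw⟩ := hz.exists_circle_map
  obtain ⟨U, hU, hUΦ⟩ := exists_lift_of_closedBall ⟨Φ ∘ h.symm, hΦ.comp h.symm.continuous⟩
  -- rounding down gives integers and keeps the differences, which are integers
  refine ⟨fun v => ⌊U (h (K.vertexPoint v))⌋, fun d => ?_⟩
  -- on a triangle, the lift differs from the affine function by a constant integer
  have hcont : Continuous fun x : stdSimplex ℝ (Fin 3) =>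
      U (h (K.trianglePoint d.t x)) - ∑ a, (x : Fin 3 → ℝ) a * w d.t a := by
    refine (hU.comp (h.continuous.comp (K.continuous_trianglePoint d.t))).sub
      (continuous_finsetSum _ fun a _ =>
      ((continuous_apply a).comp continuous_subtype_val).mul continuous_const)
  have hmaps : MapsTo (fun x : stdSimplex ℝ (Fin 3) =>
      U (h (K.trianglePoint d.t x)) - ∑ a, (x : Fin 3 → ℝ) a * w d.t a) univ
      (AddSubgroup.zmultiples (1 : ℝ)) := by
    intro x _
    rw [SetLike.mem_coe, ← QuotientAddGroup.eq_zero_iff]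
    have h1 := hUΦ (h (K.trianglePoint d.t x))
    rw [ContinuousMap.coe_mk, Function.comp_apply, h.symm_apply_apply, hΦw] at h1
    exact (AddCircle.coe_sub _ _ _).trans (sub_eq_zero.2 h1)
  have hpre : IsPreconnected (univ : Set (stdSimplex ℝ (Fin 3))) :=
    (Subtype.preconnectedSpace (convex_stdSimplex ℝ (Fin 3)).isPreconnected).isPreconnected_univ
  have hsingle : ∀ a : Fin 3, ∑ i, (Pi.single a 1 : Fin 3 → ℝ) i * w d.t i = w d.t a := by
    intro a; simp [Pi.single_apply]
  have hconst : U (h (K.vertexPoint (K.vertexAt d.rev.corner)))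
        - ∑ i, (Pi.single d.b 1 : Fin 3 → ℝ) i * w d.t i
      = U (h (K.vertexPoint (K.vertexAt d.corner)))
        - ∑ i, (Pi.single d.a 1 : Fin 3 → ℝ) i * w d.t i :=
    hpre.constant_of_mapsTo (isDiscrete_iff_discreteTopology.2
      (inferInstanceAs (DiscreteTopology (AddSubgroup.zmultiples (1 : ℝ))))) hcont.continuousOn
      hmaps (x := ⟨Pi.single d.b 1, single_mem_stdSimplex ℝ d.b⟩) (mem_univ _)
      (y := ⟨Pi.single d.a 1, single_mem_stdSimplex ℝ d.a⟩) (mem_univ _)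
  rw [hsingle, hsingle] at hconst
  have e : U (h (K.vertexPoint (K.vertexAt d.rev.corner)))
      = U (h (K.vertexPoint (K.vertexAt d.corner))) + (z d : ℤ) := by
    rw [hw d]
    push_cast
    linarith
  simp only [e, Int.floor_add_intCast]
  ring

/-- On a disk, rational cocycles are coboundaries. -/
lemma IsDisk.exists_coboundary [Finite F] (hK : K.IsDisk) {z : Side F → ℚ} (hz : K.IsCocycle z) :
    ∃ u : K.Vertex → ℚ, ∀ d, z d = u (K.vertexAt d.rev.corner) - u (K.vertexAt d.corner) := by
  have := Fintype.ofFinite F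
  -- multiply by a common denominator
  obtain ⟨N, hN⟩ := IsLocalization.exist_integer_multiples_of_finite (nonZeroDivisors ℤ) z
  choose y hy using hN
  have hN0 : (N : ℤ) ≠ 0 := nonZeroDivisors.coe_ne_zero N
  have hN0' : ((N : ℤ) : ℚ) ≠ 0 := by exact_mod_cast hN0
  have hy' : ∀ d, (y d : ℚ) = (N : ℤ) * z d := fun d => by
    have := hy d
    simpa using this
  have hyc : K.IsCocycle y := by
    refine ⟨fun d => ?_, fun d => ?_, fun t => ?_⟩
    · have : (y d.rev : ℚ) = -y d := by rw [hy', hy', hz.rev]; ring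
      exact_mod_cast this
    · have : (y (K.glue d) : ℚ) = y d := by rw [hy', hy', hz.glue]
      exact_mod_cast this
    · have : (y ⟨t, 0, 1, by decide⟩ + y ⟨t, 1, 2, by decide⟩ + y ⟨t, 2, 0, by decide⟩ : ℚ) = 0 := by
        rw [hy', hy', hy', ← mul_add, ← mul_add, hz.triangle, mul_zero]
      exact_mod_cast this
  obtain ⟨u, hu⟩ := hK.exists_coboundary_int hyc
  refine ⟨fun v => u v / (N : ℤ), fun d => ?_⟩
  rw [← sub_div, eq_div_iff hN0', mul_comm, ← hy', hu]
  push_cast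
  rfl

variable (K)

open Classical in
/-- An orientation of the edges: `1` on the sides with the chosen direction, `-1` on the others. -/
def edgeSign (d : Side F) : ℚ :=
  if d = (K.edgeAt d).out ∨ d = K.glue (K.edgeAt d).out then 1 else -1

lemma mem_edgeSides_out (d : Side F) : d ∈ K.edgeSides (K.edgeAt d).out :=
  K.edgeAt_eq_iff.1 (Quot.out_eq (K.edgeAt d)).symm

lemma edgeSign_rev (d : Side F) : K.edgeSign d.rev = -K.edgeSign d := by
  have h := K.mem_edgeSides_out d
  unfold edgeSign
  rw [edgeAt_rev]
  generalize (K.edgeAt d).out = r at *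
  rw [mem_edgeSides] at h
  have h1 := r.rev_ne
  have h2 := (K.glue r).rev_ne
  have h3 := K.glue_ne_rev r
  have h4 : (K.glue r).rev ≠ r := fun h => h3 (congrArg Side.rev h)
  rcases h with rfl | rfl | rfl | rfl
  · rw [if_neg (not_or.2 ⟨h1, h3.symm⟩), if_pos (Or.inl rfl)]
  · rw [if_neg (c := r.rev = r ∨ _) (not_or.2 ⟨h1, h3.symm⟩), Side.rev_rev, if_pos (Or.inl rfl),
      neg_neg]
  · rw [if_neg (not_or.2 ⟨h4, h2⟩), if_pos (Or.inr rfl)]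
  · rw [if_neg (c := (K.glue r).rev = r ∨ _) (not_or.2 ⟨h4, h2⟩), Side.rev_rev,
      if_pos (Or.inr rfl), neg_neg]

lemma edgeSign_glue (d : Side F) : K.edgeSign (K.glue d) = K.edgeSign d := by
  unfold edgeSign
  rw [edgeAt_glue]
  generalize (K.edgeAt d).out = r
  have e : (K.glue d = r ∨ K.glue d = K.glue r) ↔ (d = r ∨ d = K.glue r) := by
    have : K.glue d = r ↔ d = K.glue r :=
      ⟨fun h => by rw [← h, K.glue_glue], fun h => by rw [h, K.glue_glue]⟩
    rw [this, K.glue_injective.eq_iff, or_comm]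
  classical
  exact if_congr e rfl rfl

lemma edgeSign_ne_zero (d : Side F) : K.edgeSign d ≠ 0 := by
  unfold edgeSign; split_ifs <;> norm_num

/-- The coboundary of functions on the vertices. -/
def coboundary : (K.Vertex → ℚ) →ₗ[ℚ] (Side F → ℚ) where
  toFun u d := u (K.vertexAt d.rev.corner) - u (K.vertexAt d.corner)
  map_add' u u' := by funext d; simp only [Pi.add_apply]; ring
  map_smul' c u := by
    funext d; simp only [Pi.smul_apply, smul_eq_mul, RingHom.id_apply]; ring

/-- A function on the edges, as an alternating function on the directed sides. -/
def edgeCochain : (K.Edge → ℚ) →ₗ[ℚ] (Side F → ℚ) where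
  toFun x d := K.edgeSign d * x (K.edgeAt d)
  map_add' x x' := by funext d; simp only [Pi.add_apply]; ring
  map_smul' c x := by
    funext d; simp only [Pi.smul_apply, smul_eq_mul, RingHom.id_apply]; ring

lemma edgeCochain_injective : Function.Injective K.edgeCochain := by
  intro x x' h
  funext ε
  obtain ⟨d, rfl⟩ := Quot.exists_rep ε
  exact mul_left_cancel₀ (K.edgeSign_ne_zero d) (congrFun h d)

/-- The sum of a cochain over the boundary of each triangle. -/
def triangleSum (F : Type*) : (Side F → ℚ) →ₗ[ℚ] (F → ℚ) where
  toFun z t := z ⟨t, 0, 1, by decide⟩ + z ⟨t, 1, 2, by decide⟩ + z ⟨t, 2, 0, by decide⟩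
  map_add' z z' := by funext t; simp only [Pi.add_apply]; ring
  map_smul' c z := by
    funext t; simp only [Pi.smul_apply, smul_eq_mul, RingHom.id_apply]; ring

lemma isCocycle_edgeCochain {x : K.Edge → ℚ} (hx : triangleSum F (K.edgeCochain x) = 0) :
    K.IsCocycle (K.edgeCochain x) where
  rev d := by
    show K.edgeSign d.rev * x (K.edgeAt d.rev) = -(K.edgeSign d * x (K.edgeAt d))
    rw [edgeSign_rev, edgeAt_rev, neg_mul]
  glue d := by
    show K.edgeSign (K.glue d) * x (K.edgeAt (K.glue d)) = K.edgeSign d * x (K.edgeAt d)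
    rw [edgeSign_glue, edgeAt_glue]
  triangle t := congrFun hx t

/-- The Euler characteristic of a disk is at least `1`: as cocycles are coboundaries, the
dimensions `V`, `E`, `F` of the cochain groups satisfy `E - F ≤ V - 1`. -/
theorem IsDisk.one_le_eulerChar [Fintype F] {K : TriSurface F} (hK : K.IsDisk) :
    1 ≤ K.eulerChar := by
  have := Fintype.ofFinite K.Vertex
  have := Fintype.ofFinite K.Edge
  have hne : Nonempty K.Vertex := by
    obtain ⟨h⟩ := hK
    obtain ⟨⟨t, -⟩, -⟩ := Quot.exists_rep (h.symm ⟨0, by simp⟩)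
    exact ⟨K.vertexAt (t, 0)⟩
  have h1 := (triangleSum F ∘ₗ K.edgeCochain).finrank_range_add_finrank_ker
  have h2 := K.coboundary.finrank_range_add_finrank_ker
  have h3 : Module.finrank ℚ (triangleSum F ∘ₗ K.edgeCochain).range ≤ Fintype.card F := by
    refine (Submodule.finrank_le _).trans_eq ?_
    rw [Module.finrank_fintype_fun_eq_card]
  have h4 : 1 ≤ Module.finrank ℚ K.coboundary.ker := by
    rw [Submodule.one_le_finrank_iff, Submodule.ne_bot_iff]
    refine ⟨fun _ => 1, ?_, fun h => ?_⟩
    · rw [LinearMap.mem_ker]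
      funext d
      exact sub_self _
    · obtain ⟨v⟩ := hne
      exact one_ne_zero (congrFun h v)
  have h5 : Module.finrank ℚ (triangleSum F ∘ₗ K.edgeCochain).ker
      ≤ Module.finrank ℚ K.coboundary.range := by
    rw [LinearEquiv.finrank_eq (Submodule.equivMapOfInjective _ K.edgeCochain_injective _)]
    apply Submodule.finrank_mono
    rintro _ ⟨x, hx, rfl⟩
    obtain ⟨u, hu⟩ := hK.exists_coboundary (K.isCocycle_edgeCochain hx)
    exact ⟨u, (funext hu).symm⟩
  rw [Module.finrank_fintype_fun_eq_card] at h1 h2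
  unfold eulerChar
  rw [Nat.card_eq_fintype_card, Nat.card_eq_fintype_card]
  omega

end TriSurface

end GH

end

theorem mainTheorem5 {M : Type*} [MetricSpace M] (H : GH.GeneralHyperbolicManifold M)
    {F : Type*} [Fintype F] (K : GH.TriSurface F) (f : GH.TriangulatedMap K H)
    (n : ℕ) (v : Fin n → K.Vertex) (hv : Function.Injective v)
    (e e' : Fin n → GH.Side F)
    (he : ∀ i, e i ∈ K.boundaryAt (v i)) (he' : ∀ i, e' i ∈ K.boundaryAt (v i))
    (hee' : ∀ i, e i ≠ e' i)
    (hf : f.IsHMap (Set.range v)) (hgeo : f.HasGeodesicBoundary (Set.range v)) :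
    f.area ≤ (∑ i, f.exteriorAngle (e i) (e' i)) - 2 * Real.pi * K.eulerChar ∧
    f.area ≤ (∑ i, (Real.pi - f.angleSum (v i))) - 2 * Real.pi * K.eulerChar ∧
    (1 ≤ n → K.IsDisk → f.area ≤ ((n : ℝ) - 2) * Real.pi) := by
  have key := f.area_le_sum_sub_angleSum hv (fun i => ⟨e i, he i⟩) hf
  refine ⟨key.trans ?_, key, fun _ hK => key.trans ?_⟩
  · gcongr with i
    exact sub_le_sub_left (f.upperAngle_le_angleSum (he i) (he' i) (hee' i)) _
  · have h1 : (1 : ℝ) ≤ K.eulerChar := by exact_mod_cast hK.one_le_eulerChar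
    have h2 : ∑ i, (π - f.angleSum (v i)) ≤ ∑ _i : Fin n, π := by
      refine Finset.sum_le_sum fun i _ => sub_le_self _ ?_
      exact (GH.upperAngle_nonneg _ _).trans (f.upperAngle_le_angleSum (he i) (he' i) (hee' i))
    rw [Finset.sum_const, Finset.card_univ, Fintype.card_fin, nsmul_eq_mul] at h2
    nlinarith [Real.pi_pos]
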